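/- Let $d\ge 1$. For $\varphi$ in the complex Schwartz space $\mathcal S_{\mathbb C}(\mathbb R^n)$ put $\mathcal F\varphi(\xi)=\int_{\mathbb R^n}e^{-i\xi\cdot x}\varphi(x)\,dx$, and for a tempered distribution $S$ let $\mathcal F S(\varphi)=S(\mathcal F\varphi)$. Let $\gamma:\mathbb R\to[0,\infty]$ and $f:\mathbb R^d\to[0,\infty]$ be continuous, symmetric, locally integrable functions that are non-negative-definite in the sense of distributions (i.e. $\int(\varphi*\tilde\varphi)(x)f(x)\,dx\ge0$ for all real Schwartz functions $\varphi$, where $\tilde\varphi(x)=\varphi(-x)$, and likewise for $\gamma$), with $\gamma(t)<\infty$ if and only if $t\neq0$, and $f(x)<\infty$ if and only if $x\ne0$. Let $\nu$ on $\mathbb R$ and $\mu$ on $\mathbb R^d$ be their spectral measures, i.e. the tempered measures such that $\gamma=\mathcal F\nu$ and $f=\mathcal F\mu$ as tempered distributions: $\int_{\mathbb R^d} f\varphi\,dx=\int_{\mathbb R^d}\mathcal F\varphi\,d\mu$ for all $\varphi\in\mathcal S_{\mathbb C}(\mathbb R^d)$, and likewise for $\gamma$ and $\nu$. Let $\mathcal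 D(\mathbb R^{d+1})$ be the space of real $C^\infty$ functions with compact support, and for $\varphi_1,\varphi_2\in\mathcal D(\mathbb R^{d+1})$ let $$J(\varphi_1,\varphi_2)=\int_{\mathbb R^{d+1}}\int_{\mathbb R^{d+1}}\gamma(t-s)f(x-y)\varphi_1(t,x)\varphi_2(s,y)\,dt\,dx\,ds\,dy .$$ Let $\mathcal U$ be the space of real tempered distributions $S$ on $\mathbb R^{d+1}$ such that $\mathcal FS$ is a (measurable, locally integrable) function with $\int_{\mathbb R^{d+1}}|\mathcal FS(\tau,\xi)|^2\,\nu(d\tau)\mu(d\xi)<\infty$, where $S_1,S_2$ are identified if $\int|\mathcal FS_1-\mathcal FS_2|^2\,d\nu\,d\mu=0$. Suppose that Assumption A holds: $\mu(d\xi)=(2\pi)^{-d}g(\xi)\,d\xi$ and $\nu(d\tau)=(2\pi)^{-1}h(\tau)\,d\tau$ for some non-negative measurable functions $g,h$, and there is an integer $k\ge1$ with $$\int_{\{hg>0\}}\Big(\frac1{1+\tau^2+|\xi|^2}\Big)^k\frac{1}{h(\tau)g(\xi)}\,d\tau\,d\xi<\infty .$$ Then the integrals $J(\varphi_1,\varphi_2)$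 converge absolutely, $J$ is a symmetric positive semidefinite bilinear form on $\mathcal D(\mathbb R^{d+1})$, and its Hilbert space completion $\mathcal H$ coincides with $\mathcal U$: every test function $\varphi$, regarded as the distribution $\psi\mapsto\int\varphi\psi$, belongs to $\mathcal U$, and there is a linear bijection $\mathcal U\to\mathcal H$ that sends the class of $\varphi$ to its canonical image in $\mathcal H$. Moreover, under this identification, for all $S_1,S_2\in\mathcal H=\mathcal U$, the function $\mathcal FS_1\overline{\mathcal FS_2}$ is integrable with respect to $\nu\times\mu$ and $$\langle S_1,S_2\rangle_{\mathcal H}=\int_{\mathbb R^{d+1}}\mathcal FS_1(\tau,\xi)\,\overline{\mathcal FS_2(\tau,\xi)}\,\nu(d\tau)\,\mu(d\xi).$$ -/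

import Mathlib

open MeasureTheory SchwartzMap TopologicalSpace
open scoped ENNReal Distributions

noncomputable section

namespace ColoredNoise

/-- The space `ℝ^d`. -/
abbrev Space (d : ℕ) : Type := EuclideanSpace ℝ (Fin d)

/-- The space `ℝ^(d+1)` of pairs `(t, x)`, `t ∈ ℝ` and `x ∈ ℝ^d`, with its Euclidean norm. -/
abbrev SpaceTime (d : ℕ) : Type := WithLp 2 (ℝ × Space d)

/-- The real test functions `𝒟(ℝ^(d+1))`: smooth with compact support. -/
abbrev TestFn (d : ℕ) : Type := 𝓓((⊤ : Opens (SpaceTime d)), ℝ)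

section Fourier

variable {V : Type*} [NormedAddCommGroup V] [InnerProductSpace ℝ V] [FiniteDimensional ℝ V]
  [MeasurableSpace V] [BorelSpace V]

/-- Multiplication by `(2π)⁻¹` as a linear equivalence of `V`. -/
def dilation (V : Type*) [NormedAddCommGroup V] [InnerProductSpace ℝ V] : V ≃L[ℝ] V :=
  ContinuousLinearEquiv.smulLeft (Units.mk0 ((2 * Real.pi)⁻¹ : ℝ) (by positivity))

/-- The Fourier transform `(ℱ φ)(ξ) = ∫ e^{-i ξ · x} φ(x) dx` (no factor `2π` in the exponent)
on complex Schwartz functions; see `angFourier_apply`. -/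
def angFourier : 𝓢(V, ℂ) →L[ℂ] 𝓢(V, ℂ) :=
  (compCLMOfContinuousLinearEquiv ℂ (dilation V)).comp
    (FourierTransform.fourierCLM ℂ 𝓢(V, ℂ))

theorem angFourier_apply (φ : 𝓢(V, ℂ)) (ξ : V) :
    angFourier φ ξ = ∫ x, Complex.exp (-(Complex.I * (inner ℝ ξ x : ℝ))) * φ x := by
  have h : angFourier φ ξ = (FourierTransform.fourier φ : 𝓢(V, ℂ)) ((2 * Real.pi)⁻¹ • ξ) := rfl
  rw [h, SchwartzMap.fourier_coe, Real.fourier_eq']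
  refine integral_congr_ae (Filter.Eventually.of_forall fun x => ?_)
  simp only [smul_eq_mul]
  congr 2
  rw [inner_smul_right, real_inner_comm]
  have : (Real.pi : ℂ) ≠ 0 := by exact_mod_cast Real.pi_ne_zero
  push_cast
  field_simp

/-- A covariance kernel `k : V → [0, ∞]`: continuous, symmetric, locally integrable, finite exactly
off the origin, and non-negative-definite in the sense of distributions. -/
structure IsCovarianceKernel (k : V → ℝ≥0∞) : Prop where
  continuous : Continuous k
  symm : ∀ x, k (-x) = k x
  locallyIntegrable : ∀ K : Set V, IsCompact K → ∫⁻ x in K, k x < ∞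
  finite_iff : ∀ x, k x < ∞ ↔ x ≠ 0
  nonnegDefinite : ∀ φ : 𝓢(V, ℝ),
    0 ≤ ∫ x, (convolution (φ : V → ℝ) (fun z => φ (-z)) (ContinuousLinearMap.mul ℝ ℝ) volume) x
      * (k x).toReal

/-- `m` is the spectral measure of `k`: a tempered measure whose Fourier transform, as a complex
tempered distribution, is `k`. -/
structure IsSpectralMeasure (k : V → ℝ≥0∞) (m : Measure V) : Prop where
  tempered : m.HasTemperateGrowth
  integrable : ∀ φ : 𝓢(V, ℂ), Integrable (fun x => ((k x).toReal : ℂ) * φ x)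
  fourier_eq : ∀ φ : 𝓢(V, ℂ), ∫ x, ((k x).toReal : ℂ) * φ x = ∫ ξ, angFourier φ ξ ∂m

/-- The Fourier transform `ℱ S`, given by `(ℱ S)(φ) = S (ℱ φ)`, of the tempered distribution `S` is
the measurable (locally integrable) function `v`. -/
structure FourierIs (S : 𝓢'(V, ℂ)) (v : V → ℂ) : Prop where
  measurable : Measurable v
  locallyIntegrable : LocallyIntegrable v
  apply_eq : ∀ φ : 𝓢(V, ℂ), HasCompactSupport φ → S (angFourier φ) = ∫ ξ, v ξ * φ ξ

/-- `S` is a real tempered distribution: real-valued on real Schwartz functions. -/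
def IsRealDistribution (S : 𝓢'(V, ℂ)) : Prop :=
  ∀ φ : 𝓢(V, ℂ), (∀ x, (φ x).im = 0) → (S φ).im = 0

theorem integrable_mul_of_locallyIntegrable {v : V → ℂ} (hv : LocallyIntegrable v)
    {φ : 𝓢(V, ℂ)} (hφ : HasCompactSupport φ) : Integrable (fun ξ => v ξ * φ ξ) := by
  simpa [smul_eq_mul, mul_comm] using hv.integrable_smul_left_of_hasCompactSupport φ.continuous hφ

theorem FourierIs.zero : FourierIs (0 : 𝓢'(V, ℂ)) 0 where
  measurable := measurable_zero
  locallyIntegrable := locallyIntegrable_zero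
  apply_eq φ _ := by simp

theorem FourierIs.add {S₁ S₂ : 𝓢'(V, ℂ)} {v₁ v₂ : V → ℂ} (h₁ : FourierIs S₁ v₁)
    (h₂ : FourierIs S₂ v₂) : FourierIs (S₁ + S₂) (v₁ + v₂) where
  measurable := h₁.measurable.add h₂.measurable
  locallyIntegrable := h₁.locallyIntegrable.add h₂.locallyIntegrable
  apply_eq φ hφ := by
    have e : (S₁ + S₂) (angFourier φ) = S₁ (angFourier φ) + S₂ (angFourier φ) := rfl
    rw [e, h₁.apply_eq φ hφ, h₂.apply_eq φ hφ,
      ← integral_add (integrable_mul_of_locallyIntegrable h₁.locallyIntegrable hφ)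
        (integrable_mul_of_locallyIntegrable h₂.locallyIntegrable hφ)]
    simp [add_mul]

theorem FourierIs.smul {S : 𝓢'(V, ℂ)} {v : V → ℂ} (h : FourierIs S v) (c : ℝ) :
    FourierIs (c • S) (c • v) where
  measurable := h.measurable.const_smul c
  locallyIntegrable := h.locallyIntegrable.smul c
  apply_eq φ hφ := by
    have e : (c • S) (angFourier φ) = c • S (angFourier φ) := rfl
    rw [e, h.apply_eq φ hφ, ← integral_smul]
    simp [mul_assoc]

end Fourier

/-- A function on `ℝ^(d+1)` read as a function of the pair `(τ, ξ) ∈ ℝ × ℝ^d`. -/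
abbrev onPairs {d : ℕ} (v : SpaceTime d → ℂ) : ℝ × Space d → ℂ :=
  fun p => v (WithLp.toLp 2 p)

/-- `μ(dξ) = (2π)^{-d} g(ξ) dξ`, `ν(dτ) = (2π)^{-1} h(τ) dτ`, and `1/(hg) 1_{hg > 0}` is a slow
growth function. -/
def AssumptionA {d : ℕ} (ν : Measure ℝ) (μ : Measure (Space d)) : Prop :=
  ∃ (h : ℝ → ℝ) (g : Space d → ℝ), Measurable h ∧ Measurable g ∧ (∀ τ, 0 ≤ h τ) ∧ (∀ ξ, 0 ≤ g ξ) ∧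
    ν = volume.withDensity (fun τ => ENNReal.ofReal ((2 * Real.pi)⁻¹ * h τ)) ∧
    μ = volume.withDensity (fun ξ => ENNReal.ofReal (((2 * Real.pi) ^ d)⁻¹ * g ξ)) ∧
    ∃ k : ℕ, 1 ≤ k ∧
      IntegrableOn
        (fun p : ℝ × Space d => (1 / (1 + p.1 ^ 2 + ‖p.2‖ ^ 2)) ^ k * (1 / (h p.1 * g p.2)))
        {p : ℝ × Space d | 0 < h p.1 * g p.2}

section SpaceU

variable {d : ℕ}

/-- The real tempered distributions `S` on `ℝ^(d+1)` whose Fourier transform is a function with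
`∫ |ℱ S|² dν dμ < ∞`. -/
def spaceU (ν : Measure ℝ) (μ : Measure (Space d)) : Submodule ℝ 𝓢'(SpaceTime d, ℂ) where
  carrier := {S | IsRealDistribution S ∧
    ∃ v, FourierIs S v ∧ MemLp (onPairs v) 2 (ν.prod μ)}
  zero_mem' := ⟨fun φ _ => by simp, 0, FourierIs.zero, MemLp.zero⟩
  add_mem' := by
    rintro S₁ S₂ ⟨r₁, v₁, h₁, m₁⟩ ⟨r₂, v₂, h₂, m₂⟩
    refine ⟨fun φ hφ => ?_, v₁ + v₂, h₁.add h₂, m₁.add m₂⟩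
    have e : (S₁ + S₂) φ = S₁ φ + S₂ φ := rfl
    rw [e, Complex.add_im, r₁ φ hφ, r₂ φ hφ, add_zero]
  smul_mem' := by
    rintro c S ⟨r, v, h, m⟩
    refine ⟨fun φ hφ => ?_, c • v, h.smul c, m.const_smul c⟩
    have e : (c • S) φ = c • S φ := rfl
    rw [e, Complex.smul_im, r φ hφ, smul_zero]

/-- The elements `S` of `spaceU ν μ` with `∫ |ℱ S|² dν dμ = 0`. -/
def nullU (ν : Measure ℝ) (μ : Measure (Space d)) : Submodule ℝ (spaceU ν μ) where
  carrier := {S | ∃ v, FourierIs S.1 v ∧ onPairs v =ᵐ[ν.prod μ] 0}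
  zero_mem' := ⟨0, FourierIs.zero, Filter.EventuallyEq.rfl⟩
  add_mem' := by
    rintro S₁ S₂ ⟨v₁, h₁, z₁⟩ ⟨v₂, h₂, z₂⟩
    refine ⟨v₁ + v₂, h₁.add h₂, ?_⟩
    filter_upwards [z₁, z₂] with p hp₁ hp₂
    simp only [onPairs, Pi.add_apply, Pi.zero_apply] at *
    rw [hp₁, hp₂, add_zero]
  smul_mem' := by
    rintro c S ⟨v, h, z⟩
    refine ⟨c • v, h.smul c, ?_⟩
    filter_upwards [z] with p hp
    simp only [onPairs, Pi.smul_apply, Pi.zero_apply] at *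
    rw [hp, smul_zero]

/-- The space `𝒰`, in which `S₁` and `S₂` are identified if `∫ |ℱ S₁ - ℱ S₂|² dν dμ = 0`. -/
abbrev QuotU (ν : Measure ℝ) (μ : Measure (Space d)) : Type := spaceU ν μ ⧸ nullU ν μ

end SpaceU

theorem contDiff_ofReal_testFn {d : ℕ} (φ : TestFn d) :
    ContDiff ℝ ((⊤ : ℕ∞) : WithTop ℕ∞) (fun z => ((φ z : ℝ) : ℂ)) :=
  Complex.ofRealCLM.contDiff.comp φ.contDiff

/-- The test function `φ` as a complex Schwartz function. -/
def testSchwartz {d : ℕ} (φ : TestFn d) : 𝓢(SpaceTime d, ℂ) :=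
  HasCompactSupport.toSchwartzMap (f := fun z => ((φ z : ℝ) : ℂ))
    (φ.hasCompactSupport.comp_left Complex.ofReal_zero) (contDiff_ofReal_testFn φ)

/-- The test function `φ` as the tempered distribution `ψ ↦ ∫ φ ψ`. -/
def testDistribution {d : ℕ} (φ : TestFn d) : 𝓢'(SpaceTime d, ℂ) :=
  toTemperedDistributionCLM (SpaceTime d) ℂ volume (testSchwartz φ)

theorem testDistribution_apply {d : ℕ} (φ : TestFn d) (ψ : 𝓢(SpaceTime d, ℂ)) :
    testDistribution φ ψ = ∫ z, (φ z : ℂ) * ψ z := by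
  refine (toTemperedDistributionCLM_apply_apply volume (testSchwartz φ) ψ).trans ?_
  refine integral_congr_ae (Filter.Eventually.of_forall fun z => ?_)
  exact mul_comm (ψ z) (φ z : ℂ)

section SpaceH

variable {d : ℕ}

/-- The integrand `γ(t-s) f(x-y) φ₁(t,x) φ₂(s,y)` at the point `((t, x), (s, y))`. -/
def covIntegrand (γ : ℝ → ℝ≥0∞) (f : Space d → ℝ≥0∞) (φ₁ φ₂ : TestFn d)
    (p : SpaceTime d × SpaceTime d) : ℝ :=
  (γ (p.1.fst - p.2.fst)).toReal * (f (p.1.snd - p.2.snd)).toReal * φ₁ p.1 * φ₂ p.2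

/-- The noise covariance `J(φ₁, φ₂)`. -/
def noiseCov (γ : ℝ → ℝ≥0∞) (f : Space d → ℝ≥0∞) (φ₁ φ₂ : TestFn d) : ℝ :=
  ∫ p, covIntegrand γ f φ₁ φ₂ p

/-- The covariance integrals converge absolutely, and they define a symmetric, positive
semidefinite bilinear form on the test functions. -/
structure IsPreInner (γ : ℝ → ℝ≥0∞) (f : Space d → ℝ≥0∞) : Prop where
  integrable : ∀ φ₁ φ₂ : TestFn d, Integrable (covIntegrand γ f φ₁ φ₂)
  symm : ∀ φ₁ φ₂ : TestFn d, noiseCov γ f φ₁ φ₂ = noiseCov γ f φ₂ φ₁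
  nonneg : ∀ φ : TestFn d, 0 ≤ noiseCov γ f φ φ
  add_left : ∀ φ₁ φ₂ φ₃ : TestFn d,
    noiseCov γ f (φ₁ + φ₂) φ₃ = noiseCov γ f φ₁ φ₃ + noiseCov γ f φ₂ φ₃
  smul_left : ∀ (c : ℝ) (φ₁ φ₂ : TestFn d),
    noiseCov γ f (c • φ₁) φ₂ = c * noiseCov γ f φ₁ φ₂

variable {γ : ℝ → ℝ≥0∞} {f : Space d → ℝ≥0∞}

/-- The test functions, to be equipped with the inner product `J`
instead of their usual topology. -/
@[nolint unusedArguments]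
def PreH (_hJ : IsPreInner γ f) : Type := TestFn d

instance (hJ : IsPreInner γ f) : AddCommGroup (PreH hJ) := inferInstanceAs (AddCommGroup (TestFn d))

instance (hJ : IsPreInner γ f) : Module ℝ (PreH hJ) := inferInstanceAs (Module ℝ (TestFn d))

/-- The inner product `⟨φ₁, φ₂⟩ = J(φ₁, φ₂)`. -/
@[reducible] def preHCore (hJ : IsPreInner γ f) : PreInnerProductSpace.Core ℝ (PreH hJ) where
  inner φ₁ φ₂ := noiseCov γ f φ₁ φ₂
  conj_inner_symm φ₁ φ₂ := hJ.symm φ₂ φ₁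
  re_inner_nonneg φ := hJ.nonneg φ
  add_left φ₁ φ₂ φ₃ := hJ.add_left φ₁ φ₂ φ₃
  smul_left φ₁ φ₂ c := hJ.smul_left c φ₁ φ₂

instance (hJ : IsPreInner γ f) : SeminormedAddCommGroup (PreH hJ) :=
  @InnerProductSpace.Core.toSeminormedAddCommGroup ℝ (PreH hJ) _ _ _ (preHCore hJ)

instance (hJ : IsPreInner γ f) : InnerProductSpace ℝ (PreH hJ) :=
  InnerProductSpace.ofCore (preHCore hJ)

/-- The Hilbert space `ℋ`: the (Hausdorff) completion of the test functions with respect to `J`. -/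
abbrev HilbertH (hJ : IsPreInner γ f) : Type := UniformSpace.Completion (PreH hJ)

/-- A test function as an element of `PreH hJ`. -/
def toPreH (hJ : IsPreInner γ f) : TestFn d ≃ₗ[ℝ] PreH hJ := LinearEquiv.refl ℝ (TestFn d)

/-- The canonical map from the test functions to `ℋ`. -/
def toH (hJ : IsPreInner γ f) (φ : TestFn d) : HilbertH hJ :=
  UniformSpace.Completion.coe' (toPreH hJ φ)

theorem inner_toH (hJ : IsPreInner γ f) (φ₁ φ₂ : TestFn d) :
    inner ℝ (toH hJ φ₁) (toH hJ φ₂) = noiseCov γ f φ₁ φ₂ :=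
  (UniformSpace.Completion.inner_coe (𝕜 := ℝ) (toPreH hJ φ₁) (toPreH hJ φ₂)).trans rfl

end SpaceH

end ColoredNoise

end

/-! Both spaces are the same closed real subspace of a complex `L²`. Let `m` be the product of the
spectral measures, carried to space-time. Assumption A gives `m` a Lebesgue density `ρ`, and
symmetry of the kernels makes `ρ` even almost everywhere. The target is `hermitianLp`, the functions
`u` in `L²(m)` with `u(p) = conj (u(-p))`; its real inner product agrees with `∫ u conj(w) dm`,
since that integral is real for Hermitian functions.

On the side of `𝒰`, the Fourier transform of a real distribution is Hermitian
(`FourierIs.hermitian`) and unique up to Lebesgue null sets, hence up to `m`-null sets. The delicate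
point is surjectivity (`fourierU_surjective`): an element of `L²(m)` need not define a tempered
distribution. Cut off to `{ρ > 0}` it does, because the slow growth of `1/ρ` and Cauchy–Schwarz
bound its weighted `L¹` norm (`exists_integrable_indicator`). The kernel of the resulting map is
exactly the null space that is divided out.

On the side of `ℋ`, the spectral representation of the product kernel (`isSpectralPair_prod`) and
Plancherel (`IsSpectralPair.integral_covariance`) turn `J` into the inner product of the Fourier
transforms. So `J` is positive semidefinite, and the test functions embed isometrically. Their image
is dense: orthogonality to all translates of a test function makes an ordinary Fourier transform
vanish (`ae_eq_zero_of_orthogonal`). The completion is therefore all of `hermitianLp`, and composing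
one identification with the inverse of the other gives the bijection. -/

namespace ColoredNoise

open scoped ComplexConjugate ContDiff

/-! ### The Fourier transform without `2π` in the exponent -/

section AngularFourier

variable {V : Type*} [NormedAddCommGroup V] [InnerProductSpace ℝ V] [FiniteDimensional ℝ V]
  [MeasurableSpace V] [BorelSpace V]

/-- The inverse of `angFourier`. -/
noncomputable def angFourierInv : 𝓢(V, ℂ) →L[ℂ] 𝓢(V, ℂ) :=
  (FourierTransform.fourierInvCLM ℂ 𝓢(V, ℂ)).comp
    (compCLMOfContinuousLinearEquiv ℂ (dilation V).symm)

theorem angFourier_angFourierInv (φ : 𝓢(V, ℂ)) : angFourier (angFourierInv φ) = φ := by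
  ext x
  have h : angFourier (angFourierInv φ) x = (FourierTransform.fourier
      (FourierTransformInv.fourierInv (compCLMOfContinuousLinearEquiv ℂ (dilation V).symm φ)) :
        𝓢(V, ℂ)) (dilation V x) := rfl
  rw [h, FourierTransform.fourier_fourierInv_eq]
  simp

theorem angFourierInv_angFourier (φ : 𝓢(V, ℂ)) : angFourierInv (angFourier φ) = φ := by
  have h : compCLMOfContinuousLinearEquiv ℂ (dilation V).symm (angFourier φ)
      = FourierTransform.fourier φ := by
    ext x
    have : compCLMOfContinuousLinearEquiv ℂ (dilation V).symm (angFourier φ) x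
      = (FourierTransform.fourier φ : 𝓢(V, ℂ)) (dilation V ((dilation V).symm x)) := rfl
    rw [this, ContinuousLinearEquiv.apply_symm_apply]
  change FourierTransformInv.fourierInv
    (compCLMOfContinuousLinearEquiv ℂ (dilation V).symm (angFourier φ)) = φ
  rw [h, FourierTransform.fourierInv_fourier_eq]

theorem norm_exp_neg_I_mul (r : ℝ) : ‖Complex.exp (-(Complex.I * r))‖ = 1 := by
  rw [show -(Complex.I * (r : ℂ)) = ((-r : ℝ) : ℂ) * Complex.I by push_cast; ring,
    Complex.norm_exp_ofReal_mul_I]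

theorem conj_exp_neg_I_mul (r : ℝ) :
    conj (Complex.exp (-(Complex.I * r))) = Complex.exp (-(Complex.I * ((-r : ℝ) : ℂ))) := by
  rw [← Complex.exp_conj]
  simp

theorem conj_angFourier {φ ψ : 𝓢(V, ℂ)} (h : ∀ x, ψ x = conj (φ x)) (ξ : V) :
    conj (angFourier φ ξ) = angFourier ψ (-ξ) := by
  rw [angFourier_apply, angFourier_apply, ← integral_conj]
  refine integral_congr_ae (Filter.Eventually.of_forall fun x => ?_)
  simp only [map_mul, inner_neg_left, h]
  rw [conj_exp_neg_I_mul]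

/-- Reflection `φ ↦ φ(-·)` of Schwartz functions. -/
noncomputable def reflect : 𝓢(V, ℂ) →L[ℂ] 𝓢(V, ℂ) :=
  compCLMOfContinuousLinearEquiv ℂ (ContinuousLinearEquiv.neg ℝ)

omit [FiniteDimensional ℝ V] [MeasurableSpace V] [BorelSpace V] in
@[simp]
theorem reflect_apply (φ : 𝓢(V, ℂ)) (x : V) : reflect φ x = φ (-x) := rfl

theorem angFourier_reflect (φ : 𝓢(V, ℂ)) (ξ : V) :
    angFourier (reflect φ) ξ = angFourier φ (-ξ) := by
  rw [angFourier_apply, angFourier_apply, ← integral_neg_eq_self]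
  simp

/-- The kernel `e^{-iξ·x}` is symmetric in its two variables, so the transform passes across the
pairing with no constant. The `2π` of Mathlib's character is absorbed into the bilinear form. -/
theorem integral_angFourier_mul (φ ψ : 𝓢(V, ℂ)) :
    ∫ ξ, angFourier φ ξ * ψ ξ = ∫ x, φ x * angFourier ψ x := by
  have key (φ : 𝓢(V, ℂ)) (ξ : V) : angFourier φ ξ = VectorFourier.fourierIntegral
      Real.fourierChar volume ((2 * Real.pi)⁻¹ • innerₗ V) φ ξ := by
    rw [angFourier_apply, VectorFourier.fourierIntegral]
    refine integral_congr_ae (Filter.Eventually.of_forall fun x => ?_)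
    simp only [Circle.smul_def, Real.fourierChar_apply, smul_eq_mul, LinearMap.smul_apply,
      innerₗ_apply_apply]
    congr 2
    rw [real_inner_comm]
    have : (Real.pi : ℂ) ≠ 0 := by exact_mod_cast Real.pi_ne_zero
    push_cast
    field_simp
  have hL : ((2 * Real.pi)⁻¹ • innerₗ V).flip = (2 * Real.pi)⁻¹ • innerₗ V := by
    ext x y
    simp [real_inner_comm]
  simp_rw [key]
  have := VectorFourier.integral_fourierIntegral_smul_eq_flip (μ := (volume : Measure V))
    (ν := (volume : Measure V)) (L := (2 * Real.pi)⁻¹ • innerₗ V) (f := φ) (g := ψ)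
    Real.continuous_fourierChar (by
      simp only [LinearMap.smul_apply, innerₗ_apply_apply]
      fun_prop) φ.integrable ψ.integrable
  rw [hL] at this
  exact this

theorem angFourier_compSubConst (φ : 𝓢(V, ℂ)) (a ξ : V) :
    angFourier (compSubConstCLM ℂ a φ) ξ
      = Complex.exp (-(Complex.I * (inner ℝ ξ a : ℝ))) * angFourier φ ξ := by
  rw [angFourier_apply, angFourier_apply, ← integral_const_mul,
    ← integral_sub_right_eq_self _ (-a)]
  refine integral_congr_ae (Filter.Eventually.of_forall fun x => ?_)
  simp only [compSubConstCLM_apply, sub_neg_eq_add, add_sub_cancel_right, inner_add_right]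
  rw [← mul_assoc, ← Complex.exp_add]
  congr 2
  push_cast
  ring

/-- Continuity of the Fourier transform, as a decay estimate in terms of finitely many Schwartz
seminorms. -/
theorem exists_pow_mul_norm_angFourier_le (V : Type*) [NormedAddCommGroup V]
    [InnerProductSpace ℝ V] [FiniteDimensional ℝ V] [MeasurableSpace V] [BorelSpace V] (N : ℕ) :
    ∃ (s : Finset (ℕ × ℕ)) (C : ℝ), 0 ≤ C ∧ ∀ (φ : 𝓢(V, ℂ)) (ξ : V),
      ‖ξ‖ ^ N * ‖angFourier φ ξ‖ ≤ C * s.sup (schwartzSeminormFamily ℂ V ℂ) φ := by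
  have hc : Continuous ((SchwartzMap.seminorm ℂ N 0).comp
      (angFourier : 𝓢(V, ℂ) →L[ℂ] 𝓢(V, ℂ)).toLinearMap) :=
    ((schwartz_withSeminorms ℂ V ℂ).continuous_seminorm (N, 0)).comp
      (angFourier : 𝓢(V, ℂ) →L[ℂ] 𝓢(V, ℂ)).continuous
  obtain ⟨s, C, -, h⟩ := Seminorm.bound_of_continuous (schwartz_withSeminorms ℂ V ℂ) _ hc
  refine ⟨s, C, C.2, fun φ ξ => ?_⟩
  exact ((angFourier φ).norm_pow_mul_le_seminorm ℂ N ξ).trans (h φ)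

end AngularFourier

/-! ### Fourier transforms that are functions, and measures with slowly growing `1/ρ` -/

section SpectralDensity

variable {V : Type*} [NormedAddCommGroup V] [InnerProductSpace ℝ V] [FiniteDimensional ℝ V]
  [MeasurableSpace V] [BorelSpace V]

/-- A smooth compactly supported real function as a complex Schwartz function. -/
noncomputable def ofRealSchwartz (g : V → ℝ) (hg : ContDiff ℝ ∞ g) (hs : HasCompactSupport g) :
    𝓢(V, ℂ) :=
  HasCompactSupport.toSchwartzMap (f := fun z => ((g z : ℝ) : ℂ))
    (hs.comp_left Complex.ofReal_zero) (Complex.ofRealCLM.contDiff.comp hg)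

omit [FiniteDimensional ℝ V] [MeasurableSpace V] [BorelSpace V] in
theorem ofRealSchwartz_apply (g : V → ℝ) (hg : ContDiff ℝ ∞ g) (hs : HasCompactSupport g) (x : V) :
    ofRealSchwartz g hg hs x = g x := rfl

omit [FiniteDimensional ℝ V] [MeasurableSpace V] [BorelSpace V] in
theorem hasCompactSupport_ofRealSchwartz (g : V → ℝ) (hg : ContDiff ℝ ∞ g)
    (hs : HasCompactSupport g) : HasCompactSupport (ofRealSchwartz g hg hs) :=
  hs.comp_left (g := fun r : ℝ => (r : ℂ)) Complex.ofReal_zero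

/-- The Fourier transform of a tempered distribution, as a function, is unique up to null sets. -/
theorem FourierIs.ae_eq {S : 𝓢'(V, ℂ)} {v w : V → ℂ} (hv : FourierIs S v) (hw : FourierIs S w) :
    v =ᵐ[volume] w := by
  refine ae_eq_of_integral_contDiff_smul_eq hv.locallyIntegrable hw.locallyIntegrable
    fun g hg hs => ?_
  have h := (hv.apply_eq _ (hasCompactSupport_ofRealSchwartz g hg hs)).symm.trans
    (hw.apply_eq _ (hasCompactSupport_ofRealSchwartz g hg hs))
  simpa only [Complex.real_smul, ofRealSchwartz_apply, mul_comm] using h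

omit [FiniteDimensional ℝ V] [MeasurableSpace V] [BorelSpace V] in
theorem hasCompactSupport_reflect {φ : 𝓢(V, ℂ)} (hφ : HasCompactSupport φ) :
    HasCompactSupport (reflect φ) :=
  hφ.comp_homeomorph (Homeomorph.neg V)

theorem locallyIntegrable_conj_neg {v : V → ℂ} (hv : LocallyIntegrable v) :
    LocallyIntegrable fun p => conj (v (-p)) := by
  have h : LocallyIntegrable (v ∘ Homeomorph.neg V) := by
    rw [← locallyIntegrable_map_homeomorph]
    have : Measure.map (Homeomorph.neg V) (volume : Measure V) = volume :=
      (Measure.measurePreserving_neg (volume : Measure V)).map_eq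
    rwa [this]
  rw [locallyIntegrable_iff] at h ⊢
  exact fun K hK => (Complex.conjCLE.toContinuousLinearMap).integrable_comp (h K hK)

/-- The Fourier transform of a real tempered distribution is Hermitian. -/
theorem FourierIs.hermitian {S : 𝓢'(V, ℂ)} {v : V → ℂ} (hv : FourierIs S v)
    (hS : IsRealDistribution S) : ∀ᵐ p, v p = conj (v (-p)) := by
  refine ae_eq_of_integral_contDiff_smul_eq hv.locallyIntegrable
    (locallyIntegrable_conj_neg hv.locallyIntegrable) fun g hg hs => ?_
  set ψ := ofRealSchwartz g hg hs with hψ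
  have hcs : HasCompactSupport ψ := hasCompactSupport_ofRealSchwartz g hg hs
  have hconj (ξ : V) : angFourier (reflect ψ) ξ = conj (angFourier ψ ξ) := by
    rw [angFourier_reflect, conj_angFourier (ψ := ψ)]
    intro x
    rw [hψ, ofRealSchwartz_apply, Complex.conj_ofReal]
  -- Since `ψ` is real, reflecting it conjugates its transform. The sum and `i` times the difference
  -- are thus real Schwartz functions, and reality of `S` on the two gives the imaginary and the
  -- real part of `e₃`.
  have h₁ := hS (angFourier ψ + angFourier (reflect ψ)) fun ξ => by
    rw [_root_.add_apply, hconj, Complex.add_im, Complex.conj_im, add_neg_cancel]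
  have h₂ := hS (Complex.I • (angFourier ψ - angFourier (reflect ψ))) fun ξ => by
    rw [_root_.smul_apply, _root_.sub_apply, hconj]
    simp
  have e₁ := hv.apply_eq ψ hcs
  have e₂ := hv.apply_eq (reflect ψ) (hasCompactSupport_reflect hcs)
  rw [map_add] at h₁
  rw [map_smul, map_sub] at h₂
  have e₃ : S (angFourier ψ) = conj (S (angFourier (reflect ψ))) := by
    apply Complex.ext
    · simp only [smul_eq_mul, Complex.mul_im, Complex.I_re, Complex.I_im, zero_mul, one_mul,
        zero_add, Complex.sub_re] at h₂
      rw [Complex.conj_re]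
      linarith
    · rw [Complex.add_im] at h₁
      rw [Complex.conj_im]
      linarith
  rw [e₁, e₂, ← integral_conj, ← integral_neg_eq_self (fun p => conj (v p * reflect ψ p))] at e₃
  simpa only [Complex.real_smul, hψ, reflect_apply, neg_neg, ofRealSchwartz_apply, map_mul,
    Complex.conj_ofReal, mul_comm] using e₃

/-- The measure `m` has the even density `ρ`, is tempered, and `1/ρ 1_{ρ > 0}` is a slow growth
function. -/
structure IsSpectralDensity (m : Measure V) (ρ : V → ℝ) : Prop where
  measurable : Measurable ρ
  nonneg : ∀ p, 0 ≤ ρ p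
  eq_withDensity : m = volume.withDensity fun p => ENNReal.ofReal (ρ p)
  tempered : m.HasTemperateGrowth
  even : ∀ᵐ p, ρ (-p) = ρ p
  slow : ∃ k : ℕ, IntegrableOn (fun p => (1 / (1 + ‖p‖ ^ 2)) ^ k * (1 / ρ p)) {p | 0 < ρ p}

namespace IsSpectralDensity

variable {m : Measure V} {ρ : V → ℝ} (hm : IsSpectralDensity m ρ)

include hm

theorem absolutelyContinuous : m ≪ volume := by
  rw [hm.eq_withDensity]
  exact withDensity_absolutelyContinuous _ _

theorem ae_iff {P : V → Prop} : (∀ᵐ p ∂m, P p) ↔ ∀ᵐ p, 0 < ρ p → P p := by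
  rw [hm.eq_withDensity, ae_withDensity_iff hm.measurable.ennreal_ofReal]
  simp only [ne_eq, ENNReal.ofReal_eq_zero, not_le]

theorem integrable_iff {F : V → ℂ} : Integrable F m ↔ Integrable fun p => ρ p • F p := by
  rw [hm.eq_withDensity, integrable_withDensity_iff_integrable_smul' hm.measurable.ennreal_ofReal
    (Filter.Eventually.of_forall fun _ => ENNReal.ofReal_lt_top)]
  simp only [ENNReal.toReal_ofReal (hm.nonneg _)]

theorem integral_eq (F : V → ℂ) : ∫ p, F p ∂m = ∫ p, ρ p • F p := by
  rw [hm.eq_withDensity, integral_withDensity_eq_integral_toReal_smul hm.measurable.ennreal_ofReal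
    (Filter.Eventually.of_forall fun _ => ENNReal.ofReal_lt_top)]
  simp only [ENNReal.toReal_ofReal (hm.nonneg _)]

theorem measurePreserving_neg : MeasurePreserving (fun p : V => -p) m m := by
  refine ⟨measurable_neg, ?_⟩
  ext s hs
  have hr : Measurable fun p => ENNReal.ofReal (ρ p) := hm.measurable.ennreal_ofReal
  rw [Measure.map_apply measurable_neg hs, hm.eq_withDensity, withDensity_apply _ hs,
    withDensity_apply _ (measurable_neg hs),
    ← (Measure.measurePreserving_neg (volume : Measure V)).setLIntegral_comp_preimage hs hr]
  refine lintegral_congr_ae (ae_restrict_of_ae ?_)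
  filter_upwards [hm.even] with p hp
  rw [hp]

theorem memLp_schwartz (φ : 𝓢(V, ℂ)) : MemLp φ 2 m :=
  haveI := hm.tempered
  φ.memLp 2 m

theorem ae_eq_of_fourierIs {S : 𝓢'(V, ℂ)} {v w : V → ℂ} (hv : FourierIs S v)
    (hw : FourierIs S w) : v =ᵐ[m] w :=
  hm.absolutelyContinuous.ae_le (hv.ae_eq hw)

theorem hermitian {S : 𝓢'(V, ℂ)} {v : V → ℂ} (hv : FourierIs S v)
    (hS : IsRealDistribution S) : ∀ᵐ p ∂m, v p = conj (v (-p)) :=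
  hm.absolutelyContinuous.ae_le (hv.hermitian hS)

/-- A function in `L²(m)`, cut off to `{ρ > 0}`, is tempered. -/
theorem exists_integrable_indicator {u : V → ℂ} (hu : Measurable u) (h2 : MemLp u 2 m) :
    ∃ k : ℕ, Integrable fun p =>
      (((1 / (1 + ‖p‖ ^ 2)) ^ k : ℝ) : ℂ) * {p | 0 < ρ p}.indicator u p := by
  obtain ⟨k, hk⟩ := hm.slow
  have hset : MeasurableSet {p | 0 < ρ p} := measurableSet_lt measurable_const hm.measurable
  have hsq : Integrable fun p => ρ p * ‖u p‖ ^ 2 := by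
    have h := (memLp_two_iff_integrable_sq_norm h2.1).1 h2
    rw [hm.eq_withDensity, integrable_withDensity_iff_integrable_smul'
      hm.measurable.ennreal_ofReal
      (Filter.Eventually.of_forall fun _ => ENNReal.ofReal_lt_top)] at h
    simpa only [ENNReal.toReal_ofReal (hm.nonneg _), smul_eq_mul] using h
  refine ⟨k, (hsq.add (hk.integrable_indicator hset)).mono' ?_ (.of_forall fun p => ?_)⟩
  · refine AEStronglyMeasurable.mul ?_ (hu.indicator hset).aestronglyMeasurable
    exact (Continuous.aestronglyMeasurable (by
      refine Complex.continuous_ofReal.comp (Continuous.pow ?_ k)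
      exact continuous_const.div (by fun_prop) fun p => by positivity))
  · have hc0 : 0 ≤ (1 / (1 + ‖p‖ ^ 2)) ^ k := by positivity
    have hc1 : (1 / (1 + ‖p‖ ^ 2)) ^ k ≤ 1 := by
      refine pow_le_one₀ (by positivity) ?_
      rw [div_le_one (by positivity)]
      nlinarith [sq_nonneg ‖p‖]
    rw [norm_mul, Complex.norm_real, Real.norm_of_nonneg hc0]
    set c := (1 / (1 + ‖p‖ ^ 2)) ^ k with hc
    by_cases hp : 0 < ρ p
    · have hmem : p ∈ {p | 0 < ρ p} := hp
      simp only [Pi.add_apply, Set.indicator_of_mem hmem]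
      -- Pointwise Cauchy–Schwarz: split `c‖u‖` as `(√ρ ‖u‖)(c/√ρ)`. The identity completes the
      -- square; afterwards `c ≤ 1` reduces `c²` to the `c` of the slow growth condition.
      have h3 : c * ‖u p‖ ≤ ρ p * ‖u p‖ ^ 2 + c ^ 2 * (1 / ρ p) := by
        have : ρ p * ‖u p‖ ^ 2 + c ^ 2 * (1 / ρ p) - c * ‖u p‖
            = (1 / ρ p) * ((ρ p * ‖u p‖ - c / 2) ^ 2 + 3 / 4 * c ^ 2) := by
          field_simp
          ring
        have : 0 ≤ ρ p * ‖u p‖ ^ 2 + c ^ 2 * (1 / ρ p) - c * ‖u p‖ := by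
          rw [this]
          positivity
        linarith
      have h4 : c ^ 2 * (1 / ρ p) ≤ c * (1 / ρ p) := by
        gcongr
        nlinarith
      linarith
    · have hmem : p ∉ {p | 0 < ρ p} := hp
      simp only [Pi.add_apply, Set.indicator_of_notMem hmem, norm_zero, mul_zero, add_zero]
      exact mul_nonneg (hm.nonneg p) (sq_nonneg _)

end IsSpectralDensity

theorem exists_mul_norm_le_seminorm (V : Type*) [NormedAddCommGroup V] [InnerProductSpace ℝ V]
    (k : ℕ) : ∃ (s : Finset (ℕ × ℕ)) (C : ℝ), 0 ≤ C ∧ ∀ (φ : 𝓢(V, ℂ)) (x : V),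
      (1 + ‖x‖ ^ 2) ^ k * ‖φ x‖ ≤ C * s.sup (schwartzSeminormFamily ℂ V ℂ) φ := by
  refine ⟨Finset.Iic (2 * k, 0), 2 ^ (2 * k), by positivity, fun φ x => ?_⟩
  refine le_trans ?_ (one_add_le_sup_seminorm_apply (𝕜 := ℂ) (m := (2 * k, 0)) le_rfl le_rfl φ x)
  rw [norm_iteratedFDeriv_zero, pow_mul]
  gcongr
  nlinarith [norm_nonneg x]

/-- The decay of `φ` pays for the polynomial weight. Fixing the chosen seminorms and constant in the
bound, independently of `φ`, is what makes the functional below continuous. -/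
theorem integrable_tempered_mul {v : V → ℂ} {k : ℕ}
    (hv : Integrable fun p => (((1 / (1 + ‖p‖ ^ 2)) ^ k : ℝ) : ℂ) * v p) (φ : 𝓢(V, ℂ)) :
    Integrable (fun p => v p * φ p) ∧ ‖∫ p, v p * φ p‖ ≤
      (∫ p, ‖(((1 / (1 + ‖p‖ ^ 2)) ^ k : ℝ) : ℂ) * v p‖) *
        ((exists_mul_norm_le_seminorm V k).choose_spec.choose *
          (exists_mul_norm_le_seminorm V k).choose.sup (schwartzSeminormFamily ℂ V ℂ) φ) := by
  have hb := (exists_mul_norm_le_seminorm V k).choose_spec.choose_spec.2 φ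
  set C := (exists_mul_norm_le_seminorm V k).choose_spec.choose *
          (exists_mul_norm_le_seminorm V k).choose.sup (schwartzSeminormFamily ℂ V ℂ) φ
  have heq : (fun p => v p * φ p) = fun p => ((((1 + ‖p‖ ^ 2) ^ k : ℝ) : ℂ) * φ p) *
      ((((1 / (1 + ‖p‖ ^ 2)) ^ k : ℝ) : ℂ) * v p) := by
    funext p
    have : ((((1 + ‖p‖ ^ 2) ^ k : ℝ) : ℂ) * (((1 / (1 + ‖p‖ ^ 2)) ^ k : ℝ) : ℂ)) = 1 := by
      rw [← Complex.ofReal_mul, ← mul_pow, mul_one_div_cancel (by positivity), one_pow,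
        Complex.ofReal_one]
    linear_combination (-(v p * φ p)) * this
  have hn (p : V) : ‖(((1 + ‖p‖ ^ 2) ^ k : ℝ) : ℂ) * φ p‖ ≤ C := by
    rw [norm_mul, Complex.norm_real, Real.norm_of_nonneg (by positivity)]
    exact hb p
  rw [heq]
  refine ⟨hv.bdd_mul (Continuous.aestronglyMeasurable (by fun_prop)) (.of_forall hn), ?_⟩
  rw [mul_comm _ C, ← integral_const_mul]
  refine norm_integral_le_of_norm_le (hv.norm.const_mul C) (.of_forall fun p => ?_)
  rw [norm_mul]
  gcongr
  exact hn p

/-- Integration against a tempered function, as a continuous functional on Schwartz functions. -/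
noncomputable def temperedFunctional {v : V → ℂ} {k : ℕ}
    (hv : Integrable fun p => (((1 / (1 + ‖p‖ ^ 2)) ^ k : ℝ) : ℂ) * v p) : 𝓢(V, ℂ) →L[ℂ] ℂ :=
  mkCLMtoNormedSpace (fun φ => ∫ p, v p * φ p)
    (fun φ ψ => by
      rw [← integral_add (integrable_tempered_mul hv φ).1 (integrable_tempered_mul hv ψ).1]
      simp only [_root_.add_apply, mul_add])
    (fun a φ => by
      simp only [_root_.smul_apply, smul_eq_mul, RingHom.id_apply, ← integral_const_mul]
      congr 1
      funext p
      ring)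
    ⟨(exists_mul_norm_le_seminorm V k).choose,
      (∫ p, ‖(((1 / (1 + ‖p‖ ^ 2)) ^ k : ℝ) : ℂ) * v p‖) *
        (exists_mul_norm_le_seminorm V k).choose_spec.choose,
      mul_nonneg (integral_nonneg fun _ => norm_nonneg _)
        (exists_mul_norm_le_seminorm V k).choose_spec.choose_spec.1,
      fun φ => by
        rw [mul_assoc]
        exact (integrable_tempered_mul hv φ).2⟩

theorem locallyIntegrable_of_tempered {v : V → ℂ} {k : ℕ}
    (hv : Integrable fun p => (((1 / (1 + ‖p‖ ^ 2)) ^ k : ℝ) : ℂ) * v p) :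
    LocallyIntegrable v := by
  have h := LocallyIntegrable.continuous_smul
    (g := fun p : V => (((1 + ‖p‖ ^ 2) ^ k : ℝ) : ℂ)) (by fun_prop) hv.locallyIntegrable
  refine (funext fun p => ?_ : v = _) ▸ h
  rw [smul_eq_mul, ← mul_assoc, ← Complex.ofReal_mul, ← mul_pow,
    mul_one_div_cancel (by positivity), one_pow, Complex.ofReal_one, one_mul]

/-- A Hermitian tempered function is the Fourier transform of a real tempered distribution. -/
theorem exists_isReal_fourierIs {v : V → ℂ} {k : ℕ} (hmeas : Measurable v)
    (hv : Integrable fun p => (((1 / (1 + ‖p‖ ^ 2)) ^ k : ℝ) : ℂ) * v p)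
    (hh : ∀ᵐ p, v p = conj (v (-p))) :
    ∃ S : 𝓢'(V, ℂ), IsRealDistribution S ∧ FourierIs S v := by
  let T : 𝓢(V, ℂ) →L[ℂ] ℂ := (temperedFunctional hv).comp angFourierInv
  have hT (φ : 𝓢(V, ℂ)) : T φ = ∫ p, v p * angFourierInv φ p := rfl
  refine ⟨(ContinuousLinearMap.toPointwiseConvergenceCLM ℂ (RingHom.id ℂ) 𝓢(V, ℂ) ℂ) T, ?_,
    hmeas, locallyIntegrable_of_tempered hv, ?_⟩
  · intro φ hφ
    change (T φ).im = 0
    rw [← Complex.conj_eq_iff_im, hT]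
    have hinv (p : V) : conj (angFourierInv φ p) = angFourierInv φ (-p) := by
      -- The conjugate reflection of the inverse transform has transform `conj φ = φ`, so by
      -- injectivity it is the inverse transform itself.
      let χ : 𝓢(V, ℂ) := reflect (postcompCLM (𝕜 := ℝ) Complex.conjCLE.toContinuousLinearMap
        (angFourierInv φ))
      have hχ : angFourier χ = φ := by
        ext ξ
        change angFourier (reflect _) ξ = _
        rw [angFourier_reflect, ← conj_angFourier (φ := angFourierInv φ) (fun _ => rfl),
          angFourier_angFourierInv, Complex.conj_eq_iff_im]
        exact hφ ξ
      have h₁ : angFourierInv (angFourier χ) = angFourierInv φ := by rw [hχ]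
      rw [angFourierInv_angFourier] at h₁
      have h₂ : conj (angFourierInv φ (- -p)) = angFourierInv φ (-p) :=
        congrArg (fun f : 𝓢(V, ℂ) => f (-p)) h₁
      rwa [neg_neg] at h₂
    rw [← integral_conj, ← integral_neg_eq_self]
    refine integral_congr_ae ?_
    filter_upwards [hh] with p hp
    rw [map_mul, hinv, neg_neg, ← hp]
  · intro φ _
    change T (angFourier φ) = _
    rw [hT, angFourierInv_angFourier]

end SpectralDensity

/-! ### Totality of the Fourier transforms of test functions -/

section Density

variable {V : Type*} [NormedAddCommGroup V] [InnerProductSpace ℝ V] [FiniteDimensional ℝ V]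
  [MeasurableSpace V] [BorelSpace V]

/-- Injectivity of the Fourier transform on integrable functions. -/
theorem ae_eq_zero_of_fourier_eq_zero {F : V → ℂ} (hF : Integrable F)
    (h : ∀ a : V, ∫ ξ, Complex.exp (-(Complex.I * (inner ℝ a ξ : ℝ))) * F ξ = 0) :
    F =ᵐ[volume] 0 := by
  have hzero : VectorFourier.fourierIntegral Real.fourierChar volume (innerₗ V) F = 0 := by
    funext a
    rw [VectorFourier.fourierIntegral, Pi.zero_apply, ← h ((2 * Real.pi) • a)]
    refine integral_congr_ae (Filter.Eventually.of_forall fun x => ?_)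
    simp only [Circle.smul_def, Real.fourierChar_apply, smul_eq_mul, innerₗ_apply_apply,
      inner_smul_left]
    congr 2
    rw [real_inner_comm]
    simp only [conj_trivial]
    push_cast
    ring
  have key (ψ : 𝓢(V, ℂ)) : ∫ x, F x * ψ x = 0 := by
    -- Pairing the vanishing transform of `F` with the inverse transform of `ψ` is pairing `F` with
    -- `ψ`.
    have := VectorFourier.integral_fourierIntegral_smul_eq_flip (μ := (volume : Measure V))
      (ν := (volume : Measure V)) (L := innerₗ V) (f := F)
      (g := (FourierTransformInv.fourierInv ψ : 𝓢(V, ℂ)))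
      Real.continuous_fourierChar (by
        simp only [innerₗ_apply_apply]
        fun_prop) hF (SchwartzMap.integrable _)
    rw [hzero, flip_innerₗ] at this
    simp only [Pi.zero_apply, smul_eq_mul, zero_mul, integral_zero] at this
    have e : VectorFourier.fourierIntegral Real.fourierChar volume (innerₗ V)
        (FourierTransformInv.fourierInv ψ : 𝓢(V, ℂ)) = ψ := by
      change ((FourierTransform.fourier (FourierTransformInv.fourierInv ψ : 𝓢(V, ℂ)) :
        𝓢(V, ℂ)) : V → ℂ) = ψ
      rw [FourierTransform.fourier_fourierInv_eq]
    rw [e] at this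
    exact this.symm
  refine ae_eq_zero_of_integral_contDiff_smul_eq_zero hF.locallyIntegrable fun g hg hs => ?_
  rw [← key (ofRealSchwartz g hg hs)]
  simp only [ofRealSchwartz_apply, Complex.real_smul, mul_comm]

/-- The real part is `∫ cos(ξ·x) g(x) dx`. On the support of `g` the argument of the cosine is at
most `1 < π/2`, so no cancellation occurs. -/
theorem re_angFourier_ofRealSchwartz_pos {g : V → ℝ} (hg : ContDiff ℝ ∞ g)
    (hs : HasCompactSupport g) (h0 : 0 ≤ g) (h1 : g 0 ≠ 0) {ξ : V}
    (hξ : ∀ x, g x ≠ 0 → ‖x‖ * ‖ξ‖ ≤ 1) : 0 < (angFourier (ofRealSchwartz g hg hs) ξ).re := by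
  have hint : Integrable fun x => Complex.exp (-(Complex.I * (inner ℝ ξ x : ℝ))) *
      ofRealSchwartz g hg hs x := by
    refine (ofRealSchwartz g hg hs).integrable.bdd_mul (c := 1)
      (Continuous.aestronglyMeasurable (by fun_prop)) (.of_forall fun x => ?_)
    rw [norm_exp_neg_I_mul]
  rw [angFourier_apply, ← RCLike.re_eq_complex_re, ← integral_re hint]
  have hre (x : V) : RCLike.re (Complex.exp (-(Complex.I * (inner ℝ ξ x : ℝ))) *
      ofRealSchwartz g hg hs x) = Real.cos (inner ℝ ξ x) * g x := by
    rw [ofRealSchwartz_apply, RCLike.re_eq_complex_re, Complex.re_mul_ofReal,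
      show -(Complex.I * ((inner ℝ ξ x : ℝ) : ℂ)) = ((-inner ℝ ξ x : ℝ) : ℂ) * Complex.I by
        push_cast; ring, Complex.exp_ofReal_mul_I_re, Real.cos_neg]
  simp_rw [hre]
  have hgc := hg.continuous
  refine Continuous.integral_pos_of_hasCompactSupport_nonneg_nonzero (x := 0) (by fun_prop)
    hs.mul_left (fun x => ?_) (by simpa using h1)
  by_cases hx : g x = 0
  · simp [hx]
  · refine mul_nonneg (Real.cos_nonneg_of_mem_Icc ?_) (h0 x)
    have h2 : |inner ℝ ξ x| ≤ 1 :=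
      (abs_real_inner_le_norm ξ x).trans (by rw [mul_comm]; exact hξ x hx)
    have h3 := Real.pi_gt_three
    constructor <;> linarith [abs_le.1 h2]

/-- A countable family of test functions whose Fourier transforms have no common zero. -/
theorem exists_seq_testFn (V : Type*) [NormedAddCommGroup V] [InnerProductSpace ℝ V]
    [FiniteDimensional ℝ V] [MeasurableSpace V] [BorelSpace V] :
    ∃ φ : ℕ → 𝓢(V, ℂ), (∀ n x, (φ n x).im = 0) ∧ (∀ n, HasCompactSupport (φ n)) ∧
      ∀ ξ : V, ∃ n, angFourier (φ n) ξ ≠ 0 := by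
  -- The outer radius `1/(n+1)` makes `‖x‖‖ξ‖ ≤ 1` on the support as soon as `n ≥ ‖ξ‖`. The inner
  -- radius only has to be positive and smaller.
  let b (n : ℕ) : ContDiffBump (0 : V) := ⟨1 / (n + 2), 1 / (n + 1), by positivity, by
    gcongr; norm_num⟩
  refine ⟨fun n => ofRealSchwartz (b n) (b n).contDiff (b n).hasCompactSupport,
    fun n x => by rw [ofRealSchwartz_apply, Complex.ofReal_im],
    fun n => hasCompactSupport_ofRealSchwartz _ _ _, fun ξ => ?_⟩
  obtain ⟨n, hn⟩ := exists_nat_ge ‖ξ‖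
  refine ⟨n, fun h0 => ?_⟩
  have h1 : (b n) 0 ≠ 0 := by
    rw [(b n).one_of_mem_closedBall (Metric.mem_closedBall_self (b n).rIn_pos.le)]
    exact one_ne_zero
  have := re_angFourier_ofRealSchwartz_pos (b n).contDiff (b n).hasCompactSupport
    (fun x => (b n).nonneg) h1 (ξ := ξ) fun x hx => by
      have hx' : x ∈ Function.support (b n) := hx
      rw [(b n).support_eq, mem_ball_zero_iff] at hx'
      have h2 : (b n).rOut = 1 / (n + 1) := rfl
      rw [h2] at hx'
      calc ‖x‖ * ‖ξ‖ ≤ 1 / (n + 1) * n := by gcongr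
        _ ≤ 1 := by
          rw [one_div_mul_eq_div, div_le_one (by positivity)]
          linarith
  rw [h0] at this
  simp at this

omit [FiniteDimensional ℝ V] [MeasurableSpace V] [BorelSpace V] in
theorem hasCompactSupport_compSubConst {φ : 𝓢(V, ℂ)} (hφ : HasCompactSupport φ) (a : V) :
    HasCompactSupport (compSubConstCLM ℂ a φ) :=
  hφ.comp_homeomorph (Homeomorph.subRight a)

/-- The Fourier transforms of real test functions are total in the Hermitian functions of `L²`. -/
theorem IsSpectralDensity.ae_eq_zero_of_orthogonal {m : Measure V} {ρ : V → ℝ}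
    (hm : IsSpectralDensity m ρ) {u : V → ℂ} (h2 : MemLp u 2 m)
    (horth : ∀ φ : 𝓢(V, ℂ), (∀ x, (φ x).im = 0) → HasCompactSupport φ →
      ∫ p, u p * conj (angFourier φ p) ∂m = 0) : u =ᵐ[m] 0 := by
  obtain ⟨φ, hre, hcs, hne⟩ := exists_seq_testFn V
  have key (n : ℕ) : ∀ᵐ p ∂m, u p * conj (angFourier (φ n) p) = 0 := by
    have hi : Integrable (fun p => u p * conj (angFourier (φ n) p)) m :=
      MemLp.integrable_mul h2 (hm.memLp_schwartz _).star
    -- Translating `φ n` by `-a` puts the phase `e^{-ia·p}` into the orthogonality relation. Letting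
    -- `a` vary, it says that the Fourier transform of the integrable function `ρ u conj(ℱ(φ n))`
    -- vanishes identically.
    have h0 := ae_eq_zero_of_fourier_eq_zero (hm.integrable_iff.1 hi) fun a => by
      rw [← horth (compSubConstCLM ℂ (-a) (φ n)) (fun x => hre n _)
        (hasCompactSupport_compSubConst (hcs n) _), hm.integral_eq]
      refine integral_congr_ae (.of_forall fun p => ?_)
      simp only [angFourier_compSubConst, map_mul, conj_exp_neg_I_mul, inner_neg_right, neg_neg,
        Complex.real_smul, real_inner_comm]
      ring
    rw [hm.ae_iff]
    filter_upwards [h0] with p hp hρ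
    exact (smul_eq_zero.1 hp).resolve_left hρ.ne'
  filter_upwards [ae_all_iff.2 key] with p hp
  obtain ⟨n, hn⟩ := hne p
  exact (mul_eq_zero.1 (hp n)).resolve_right (by simpa using hn)

end Density

/-! ### Slices and the partial Fourier transform on a product space -/

section Product

variable {W E : Type*} [NormedAddCommGroup W] [InnerProductSpace ℝ W]
  [NormedAddCommGroup E] [InnerProductSpace ℝ E]

theorem contDiff_toLp_prod : ContDiff ℝ ∞ (WithLp.toLp 2 : W × E → WithLp 2 (W × E)) :=
  (WithLp.prodContinuousLinearEquiv 2 ℝ W E).symm.contDiff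

theorem hasCompactSupport_slice {φ : 𝓢(WithLp 2 (W × E), ℂ)} (hφ : HasCompactSupport φ) (x : E) :
    HasCompactSupport fun t : W => φ (WithLp.toLp 2 (t, x)) := by
  have hK : IsCompact ((fun p : WithLp 2 (W × E) => p.fst) '' tsupport φ) :=
    IsCompact.image hφ ((WithLp.prod_continuous_ofLp 2 W E).fst)
  refine HasCompactSupport.of_support_subset_isCompact hK fun t ht => ?_
  exact ⟨_, subset_tsupport _ ht, rfl⟩

theorem contDiff_slice (φ : 𝓢(WithLp 2 (W × E), ℂ)) (x : E) :
    ContDiff ℝ ∞ fun t : W => φ (WithLp.toLp 2 (t, x)) :=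
  (φ.smooth ⊤).comp (contDiff_toLp_prod.comp (contDiff_id.prodMk contDiff_const))

/-- The function `t ↦ φ(t, x)`. -/
noncomputable def slice (φ : 𝓢(WithLp 2 (W × E), ℂ)) (hφ : HasCompactSupport φ) (x : E) : 𝓢(W, ℂ) :=
  (hasCompactSupport_slice hφ x).toSchwartzMap (contDiff_slice φ x)

theorem slice_apply (φ : 𝓢(WithLp 2 (W × E), ℂ)) (hφ : HasCompactSupport φ) (x : E) (t : W) :
    slice φ hφ x t = φ (WithLp.toLp 2 (t, x)) := rfl

/-- A slice is a translate of `φ` composed with an embedding of norm at most `1`, and `‖t‖ ≤ ‖(t,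
x)‖`. The bound is uniform in `x`, which later gives the integrable majorant for Fubini. -/
theorem seminorm_slice_le (φ : 𝓢(WithLp 2 (W × E), ℂ)) (hφ : HasCompactSupport φ) (x : E)
    (k n : ℕ) : SchwartzMap.seminorm ℂ k n (slice φ hφ x) ≤ SchwartzMap.seminorm ℂ k n φ := by
  refine seminorm_le_bound ℂ k n _ (apply_nonneg _ _) fun t => ?_
  refine le_trans ?_ (le_seminorm ℂ k n φ (WithLp.toLp 2 (t, x)))
  let ι : W →L[ℝ] WithLp 2 (W × E) := ((WithLp.prodContinuousLinearEquiv 2 ℝ W E).symm :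
    W × E →L[ℝ] WithLp 2 (W × E)).comp (ContinuousLinearMap.inl ℝ W E)
  have hι (t : W) : ι t = WithLp.toLp 2 (t, 0) := rfl
  have hadd (t : W) : ι t + WithLp.toLp 2 (0, x) = WithLp.toLp 2 (t, x) := by
    rw [hι, ← WithLp.toLp_add, Prod.mk_add_mk, add_zero, zero_add]
  have hnorm : ‖ι‖ ≤ 1 := by
    refine ι.opNorm_le_bound zero_le_one fun t => ?_
    rw [one_mul, hι, WithLp.norm_toLp_fst]
  have he : (slice φ hφ x : W → ℂ) = (fun p => φ (p + WithLp.toLp 2 (0, x))) ∘ ι := by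
    funext t
    rw [slice_apply, Function.comp_apply, hadd]
  have hsm : ContDiff ℝ ∞ fun p => φ (p + WithLp.toLp 2 (0, x)) :=
    (φ.smooth ⊤).comp (contDiff_id.add contDiff_const)
  rw [he, ι.iteratedFDeriv_comp_right hsm t (by exact_mod_cast le_top),
    iteratedFDeriv_comp_add_right, hadd]
  gcongr
  · have h2 := WithLp.prod_norm_sq_eq_of_L2 (WithLp.toLp 2 (t, x))
    refine le_of_sq_le_sq ?_ (norm_nonneg _)
    rw [h2]
    change ‖t‖ ^ 2 ≤ ‖t‖ ^ 2 + ‖x‖ ^ 2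
    nlinarith [sq_nonneg ‖x‖]
  · refine (ContinuousMultilinearMap.norm_compContinuousLinearMap_le _ _).trans ?_
    refine mul_le_of_le_one_right (norm_nonneg _) ?_
    exact Finset.prod_le_one (fun _ _ => norm_nonneg _) fun _ _ => hnorm

variable [FiniteDimensional ℝ W] [MeasurableSpace W] [BorelSpace W]

theorem exists_pow_mul_norm_angFourier_slice_le (φ : 𝓢(WithLp 2 (W × E), ℂ))
    (hφ : HasCompactSupport φ) (N : ℕ) :
    ∃ C, ∀ (x : E) (τ : W), ‖τ‖ ^ N * ‖angFourier (slice φ hφ x) τ‖ ≤ C := by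
  obtain ⟨s, C, hC, h⟩ := exists_pow_mul_norm_angFourier_le W N
  refine ⟨C * s.sup (schwartzSeminormFamily ℂ (WithLp 2 (W × E)) ℂ) φ, fun x τ => ?_⟩
  refine (h _ τ).trans ?_
  gcongr
  refine Seminorm.finset_sup_apply_le (apply_nonneg _ _) fun i hi => ?_
  refine (seminorm_slice_le φ hφ x i.1 i.2).trans ?_
  exact Seminorm.le_finset_sup_apply (p := schwartzSeminormFamily ℂ (WithLp 2 (W × E)) ℂ) hi

theorem exists_norm_angFourier_slice_le (φ : 𝓢(WithLp 2 (W × E), ℂ)) (hφ : HasCompactSupport φ)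
    (l : ℕ) : ∃ C, ∀ (x : E) (τ : W),
      ‖angFourier (slice φ hφ x) τ‖ ≤ C * (1 + ‖τ‖) ^ (-(l : ℝ)) := by
  obtain ⟨C₁, h₁⟩ := exists_pow_mul_norm_angFourier_slice_le φ hφ 0
  obtain ⟨C₂, h₂⟩ := exists_pow_mul_norm_angFourier_slice_le φ hφ l
  refine ⟨2 ^ l * (C₁ + C₂), fun x τ => ?_⟩
  have := pow_mul_le_of_le_of_pow_mul_le (k := 0) (l := l) (norm_nonneg τ) (norm_nonneg _)
    (by simpa using h₁ x τ) (by simpa using h₂ x τ)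
  simpa using this

theorem contDiff_angFourier_slice (φ : 𝓢(WithLp 2 (W × E), ℂ)) (hφ : HasCompactSupport φ)
    (τ : W) : ContDiff ℝ ∞ fun x : E => angFourier (slice φ hφ x) τ := by
  have hK : IsCompact ((fun p : WithLp 2 (W × E) => p.fst) '' tsupport φ) :=
    IsCompact.image hφ ((WithLp.prod_continuous_ofLp 2 W E).fst)
  -- The transform at `τ` is the convolution of `e^{iτ·t}` with the slice, evaluated at `0`.
  -- Smoothness in `x` is then smooth dependence of a convolution on a parameter.
  have h := contDiffOn_convolution_right_with_param_comp (𝕜 := ℝ) (n := ⊤)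
    (μ := (volume : Measure W)) (ContinuousLinearMap.mul ℝ ℂ) (s := Set.univ)
    (v := fun _ : E => (0 : W)) contDiffOn_const
    (f := fun t => Complex.exp (-(Complex.I * (inner ℝ τ (-t) : ℝ))))
    (g := fun x t => φ (WithLp.toLp 2 (t, x))) isOpen_univ hK
    (fun x t _ ht => by
      by_contra h0
      exact ht ⟨_, subset_tsupport _ h0, rfl⟩)
    (Continuous.locallyIntegrable (by fun_prop))
    (((φ.smooth ⊤).comp (contDiff_toLp_prod.comp
      (contDiff_snd.prodMk contDiff_fst))).contDiffOn)
  rw [contDiffOn_univ] at h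
  refine (funext fun x => ?_ : _ = fun x : E => angFourier (slice φ hφ x) τ) ▸ h
  rw [angFourier_apply, convolution_def, ← integral_neg_eq_self]
  simp [slice_apply]

theorem hasCompactSupport_angFourier_slice (φ : 𝓢(WithLp 2 (W × E), ℂ)) (hφ : HasCompactSupport φ)
    (τ : W) : HasCompactSupport fun x : E => angFourier (slice φ hφ x) τ := by
  have hK : IsCompact ((fun p : WithLp 2 (W × E) => p.snd) '' tsupport φ) :=
    IsCompact.image hφ ((WithLp.prod_continuous_ofLp 2 W E).snd)
  refine HasCompactSupport.of_support_subset_isCompact hK fun x hx => ?_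
  by_contra h0
  have : slice φ hφ x = 0 := by
    ext t
    by_contra h1
    exact h0 ⟨_, subset_tsupport _ h1, rfl⟩
  rw [Function.mem_support, this, map_zero] at hx
  exact hx rfl

/-- The partial Fourier transform `x ↦ ∫ e^{-i τ t} φ(t, x) dt`. -/
noncomputable def partialFourier (φ : 𝓢(WithLp 2 (W × E), ℂ)) (hφ : HasCompactSupport φ) (τ : W) :
    𝓢(E, ℂ) :=
  (hasCompactSupport_angFourier_slice φ hφ τ).toSchwartzMap (contDiff_angFourier_slice φ hφ τ)

variable [FiniteDimensional ℝ E] [MeasurableSpace E] [BorelSpace E]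

theorem integrable_comp_toLp (φ : 𝓢(WithLp 2 (W × E), ℂ)) :
    Integrable fun q : W × E => φ (WithLp.toLp 2 q) :=
  (WithLp.volume_preserving_toLp W E).integrable_comp_of_integrable φ.integrable

theorem angFourier_partialFourier (φ : 𝓢(WithLp 2 (W × E), ℂ)) (hφ : HasCompactSupport φ) (τ : W)
    (ξ : E) : angFourier (partialFourier φ hφ τ) ξ = angFourier φ (WithLp.toLp 2 (τ, ξ)) := by
  have hmp := WithLp.volume_preserving_toLp W E
  have he : MeasurableEmbedding (WithLp.toLp 2 : W × E → WithLp 2 (W × E)) :=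
    (MeasurableEquiv.toLp 2 (W × E)).measurableEmbedding
  rw [angFourier_apply, angFourier_apply, ← hmp.integral_comp he, Measure.volume_eq_prod,
    integral_prod_symm]
  · refine integral_congr_ae (.of_forall fun x => ?_)
    change Complex.exp _ * angFourier (slice φ hφ x) τ = _
    rw [angFourier_apply, ← integral_const_mul]
    refine integral_congr_ae (.of_forall fun t => ?_)
    simp only [slice_apply, WithLp.prod_inner_apply]
    rw [← mul_assoc, ← Complex.exp_add]
    congr 2
    push_cast
    ring
  · refine (integrable_comp_toLp φ).bdd_mul (c := 1) (Continuous.aestronglyMeasurable ?_)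
      (.of_forall fun x => ?_)
    · have := (WithLp.prod_continuous_toLp 2 W E)
      fun_prop
    · rw [norm_exp_neg_I_mul]

theorem stronglyMeasurable_angFourier_slice (φ : 𝓢(WithLp 2 (W × E), ℂ))
    (hφ : HasCompactSupport φ) :
    StronglyMeasurable fun q : W × E => angFourier (slice φ hφ q.2) q.1 := by
  simp_rw [angFourier_apply, slice_apply]
  refine StronglyMeasurable.integral_prod_right (f := fun (q : W × E) (t : W) =>
    Complex.exp (-(Complex.I * (inner ℝ q.1 t : ℝ))) * φ (WithLp.toLp 2 (t, q.2))) ?_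
  have := (WithLp.prod_continuous_toLp 2 W E)
  have h : Continuous fun p : (W × E) × W => WithLp.toLp 2 (p.2, p.1.2) := this.comp (by fun_prop)
  exact Continuous.stronglyMeasurable (by
    simp only [Function.uncurry_def]
    fun_prop)

end Product

/-! ### Covariance kernels and evenness of the spectral density -/

section Kernel

variable {V : Type*} [NormedAddCommGroup V] [InnerProductSpace ℝ V] [FiniteDimensional ℝ V]
  [MeasurableSpace V] [BorelSpace V]

theorem IsCovarianceKernel.integrableOn {k : V → ℝ≥0∞} (hk : IsCovarianceKernel k) {K : Set V}
    (hK : IsCompact K) : IntegrableOn (fun x => (k x).toReal) K :=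
  integrable_toReal_of_lintegral_ne_top hk.continuous.measurable.aemeasurable
    (hk.locallyIntegrable K hK).ne

/-- `m` is the spectral measure of the locally integrable function `k`, tested on compactly
supported Schwartz functions. -/
structure IsSpectralPair (k : V → ℝ) (m : Measure V) : Prop where
  locallyIntegrable : LocallyIntegrable k
  tempered : m.HasTemperateGrowth
  sFinite : SFinite m
  fourier_eq : ∀ φ : 𝓢(V, ℂ), HasCompactSupport φ →
    ∫ x, (k x : ℂ) * φ x = ∫ ξ, angFourier φ ξ ∂m

/-- The density of the spectral measure of a symmetric kernel is even. -/
theorem IsSpectralMeasure.density_even {k : V → ℝ≥0∞} {m : Measure V}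
    (hs : ∀ x, k (-x) = k x) (hm : IsSpectralMeasure k m) {h : V → ℝ} (hmeas : Measurable h)
    (h0 : ∀ ξ, 0 ≤ h ξ) (heq : m = volume.withDensity fun ξ => ENNReal.ofReal (h ξ)) :
    ∀ᵐ ξ, h (-ξ) = h ξ := by
  have hfin : ∀ᵐ ξ : V, ENNReal.ofReal (h ξ) < ⊤ := .of_forall fun _ => ENNReal.ofReal_lt_top
  have hint (F : V → ℂ) : ∫ ξ, F ξ ∂m = ∫ ξ, h ξ • F ξ := by
    rw [heq, integral_withDensity_eq_integral_toReal_smul hmeas.ennreal_ofReal hfin]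
    simp only [ENNReal.toReal_ofReal (h0 _)]
  have hloc : LocallyIntegrable h := by
    obtain ⟨n, hn⟩ := hm.tempered.exists_integrable
    rw [heq, integrable_withDensity_iff_integrable_smul' hmeas.ennreal_ofReal hfin] at hn
    simp only [ENNReal.toReal_ofReal (h0 _)] at hn
    have := LocallyIntegrable.continuous_smul (g := fun ξ : V => (1 + ‖ξ‖) ^ n) (by fun_prop)
      hn.locallyIntegrable
    refine (funext fun ξ => ?_ : h = _) ▸ this
    have hp : (0 : ℝ) < 1 + ‖ξ‖ := by positivity
    rw [smul_eq_mul, smul_eq_mul, Real.rpow_neg hp.le, Real.rpow_natCast]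
    field_simp
  -- Every Schwartz function is a Fourier transform, so symmetry of `k` becomes reflection
  -- invariance of `m`.
  have hrefl (ψ : 𝓢(V, ℂ)) : ∫ ξ, reflect ψ ξ ∂m = ∫ ξ, ψ ξ ∂m := by
    have e : reflect ψ = angFourier (reflect (angFourierInv ψ)) := by
      ext ξ
      rw [angFourier_reflect, angFourier_angFourierInv, reflect_apply]
    rw [e]
    nth_rewrite 2 [← angFourier_angFourierInv ψ]
    rw [← hm.fourier_eq, ← hm.fourier_eq, ← integral_neg_eq_self]
    simp only [reflect_apply, neg_neg, hs]
  have hloc' : LocallyIntegrable fun ξ => h (-ξ) := by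
    have : LocallyIntegrable (h ∘ Homeomorph.neg V) := by
      rw [← locallyIntegrable_map_homeomorph]
      have : Measure.map (Homeomorph.neg V) (volume : Measure V) = volume :=
        (Measure.measurePreserving_neg (volume : Measure V)).map_eq
      rwa [this]
    exact this
  refine ae_eq_of_integral_contDiff_smul_eq hloc' hloc fun g hg hgs => ?_
  have := hrefl (ofRealSchwartz g hg hgs)
  rw [hint, hint, ← integral_neg_eq_self] at this
  simp only [reflect_apply, neg_neg, ofRealSchwartz_apply, Complex.real_smul,
    ← Complex.ofReal_mul, integral_complex_ofReal, Complex.ofReal_inj] at this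
  simpa only [smul_eq_mul, mul_comm] using this

end Kernel

/-! ### The spectral measure of a product kernel -/

section ProductKernel

variable {W E : Type*} [NormedAddCommGroup W] [InnerProductSpace ℝ W] [FiniteDimensional ℝ W]
  [MeasurableSpace W] [BorelSpace W] [NormedAddCommGroup E] [InnerProductSpace ℝ E]
  [FiniteDimensional ℝ E] [MeasurableSpace E] [BorelSpace E]

omit [InnerProductSpace ℝ W] [FiniteDimensional ℝ W] in
-- Each coordinate norm is at most the product norm, so `(1+‖p‖)^{-(a+b)}` is dominated by the
-- product of the two integrable weights.
theorem hasTemperateGrowth_map_toLp {ν : Measure W} {μ : Measure E} [SFinite ν] [SFinite μ]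
    (hν : ν.HasTemperateGrowth) (hμ : μ.HasTemperateGrowth) :
    ((ν.prod μ).map (WithLp.toLp 2)).HasTemperateGrowth := by
  obtain ⟨a, ha⟩ := hν.exists_integrable
  obtain ⟨b, hb⟩ := hμ.exists_integrable
  refine ⟨a + b, ?_⟩
  have he : MeasurableEmbedding (WithLp.toLp 2 : W × E → WithLp 2 (W × E)) :=
    (MeasurableEquiv.toLp 2 (W × E)).measurableEmbedding
  rw [he.integrable_map_iff]
  have h1 (q : W × E) : ‖q.1‖ ≤ ‖WithLp.toLp 2 q‖ := by
    refine le_of_sq_le_sq ?_ (norm_nonneg _)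
    rw [WithLp.prod_norm_sq_eq_of_L2]
    exact le_add_of_nonneg_right (sq_nonneg _)
  have h2 (q : W × E) : ‖q.2‖ ≤ ‖WithLp.toLp 2 q‖ := by
    refine le_of_sq_le_sq ?_ (norm_nonneg _)
    rw [WithLp.prod_norm_sq_eq_of_L2]
    exact le_add_of_nonneg_left (sq_nonneg _)
  refine (ha.mul_prod hb).mono' ?_ (.of_forall fun q => ?_)
  · exact ((measurable_norm.const_add 1).pow_const _).comp he.measurable |>.aestronglyMeasurable
  · have hp (x : ℝ) (hx : 0 ≤ x) (n : ℕ) : (1 + x) ^ (-(n : ℝ)) = ((1 + x) ^ n)⁻¹ := by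
      rw [Real.rpow_neg (by positivity), Real.rpow_natCast]
    rw [Function.comp_apply, Real.norm_of_nonneg (by positivity), hp _ (norm_nonneg _),
      hp _ (norm_nonneg _), hp _ (norm_nonneg _), ← mul_inv, pow_add]
    gcongr
    exacts [h1 q, h2 q]

theorem integrable_kernel_mul {γ : W → ℝ≥0∞} {f : E → ℝ≥0∞} (hγ : IsCovarianceKernel γ)
    (hf : IsCovarianceKernel f) {K₁ : Set W} {K₂ : Set E} (h₁ : IsCompact K₁) (h₂ : IsCompact K₂) :
    IntegrableOn (fun q : W × E => (γ q.1).toReal * (f q.2).toReal) (K₁ ×ˢ K₂) := by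
  rw [IntegrableOn, Measure.volume_eq_prod, ← Measure.prod_restrict]
  exact (hγ.integrableOn h₁).mul_prod (hf.integrableOn h₂)

theorem locallyIntegrable_kernel {γ : W → ℝ≥0∞} {f : E → ℝ≥0∞} (hγ : IsCovarianceKernel γ)
    (hf : IsCovarianceKernel f) :
    LocallyIntegrable fun p : WithLp 2 (W × E) => (γ p.fst).toReal * (f p.snd).toReal := by
  rw [locallyIntegrable_iff]
  intro K hK
  have h₁ := hK.image (WithLp.prod_continuous_ofLp 2 W E).fst
  have h₂ := hK.image (WithLp.prod_continuous_ofLp 2 W E).snd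
  have he : MeasurableEmbedding (WithLp.toLp 2 : W × E → WithLp 2 (W × E)) :=
    (MeasurableEquiv.toLp 2 (W × E)).measurableEmbedding
  rw [← (WithLp.volume_preserving_toLp W E).integrableOn_comp_preimage he]
  refine (integrable_kernel_mul hγ hf h₁ h₂).mono_set fun q hq => ?_
  exact ⟨⟨_, hq, rfl⟩, ⟨_, hq, rfl⟩⟩

/-- The spectral measure of a product kernel is the product of the spectral measures. -/
theorem isSpectralPair_prod {γ : W → ℝ≥0∞} {f : E → ℝ≥0∞} (hγ : IsCovarianceKernel γ)
    (hf : IsCovarianceKernel f) {ν : Measure W} {μ : Measure E} [SFinite ν] [SFinite μ]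
    (hν : IsSpectralMeasure γ ν) (hμ : IsSpectralMeasure f μ) :
    IsSpectralPair (fun p : WithLp 2 (W × E) => (γ p.fst).toReal * (f p.snd).toReal)
      ((ν.prod μ).map (WithLp.toLp 2)) := by
  have hmp := WithLp.volume_preserving_toLp W E
  have he : MeasurableEmbedding (WithLp.toLp 2 : W × E → WithLp 2 (W × E)) :=
    (MeasurableEquiv.toLp 2 (W × E)).measurableEmbedding
  have htemp := hasTemperateGrowth_map_toLp hν.tempered hμ.tempered
  refine ⟨locallyIntegrable_kernel hγ hf, htemp, inferInstance, fun φ hφ => ?_⟩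
  have hint : Integrable fun p : WithLp 2 (W × E) =>
      (((γ p.fst).toReal * (f p.snd).toReal : ℝ) : ℂ) * φ p := by
    have := (locallyIntegrable_kernel hγ hf).integrable_smul_right_of_hasCompactSupport
      φ.continuous hφ
    simpa only [Complex.real_smul] using this
  have hint' : Integrable fun q : W × E =>
      (((γ q.1).toReal * (f q.2).toReal : ℝ) : ℂ) * φ (WithLp.toLp 2 q) :=
    hmp.integrable_comp_of_integrable hint
  rw [← hmp.integral_comp he]
  change ∫ q : W × E, (((γ q.1).toReal * (f q.2).toReal : ℝ) : ℂ) * φ (WithLp.toLp 2 q) = _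
  rw [Measure.volume_eq_prod, integral_prod_symm _ hint']
  have hang : Integrable (fun q : W × E => angFourier φ (WithLp.toLp 2 q)) (ν.prod μ) :=
    he.integrable_map_iff.1 ((angFourier φ).integrable (hμ := htemp))
  rw [he.integral_map, integral_prod _ hang]
  have hK : IsCompact ((fun p : WithLp 2 (W × E) => p.snd) '' tsupport φ) :=
    IsCompact.image hφ ((WithLp.prod_continuous_ofLp 2 W E).snd)
  set K := (fun p : WithLp 2 (W × E) => p.snd) '' tsupport φ with hKdef
  -- This licenses exchanging `dx` and `ν`. The majorant is a power of `1 + ‖τ‖` integrable for `ν`,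
  -- times `f` cut off to the compact projection `K` of the support.
  have hH : Integrable (fun q : W × E => ((f q.2).toReal : ℂ) * angFourier (slice φ hφ q.2) q.1)
      (ν.prod volume) := by
    have := hν.tempered
    obtain ⟨C, hC⟩ := exists_norm_angFourier_slice_le φ hφ ν.integrablePower
    have hd := ((Measure.integrable_pow_neg_integrablePower ν).const_mul C).mul_prod
      ((hf.integrableOn hK).integrable_indicator hK.measurableSet)
    refine hd.mono' ?_ (.of_forall fun q => ?_)
    · refine AEStronglyMeasurable.mul ?_
        (stronglyMeasurable_angFourier_slice φ hφ).aestronglyMeasurable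
      have := hf.continuous.measurable
      exact Measurable.aestronglyMeasurable (by fun_prop)
    · rw [norm_mul, Complex.norm_real, Real.norm_of_nonneg ENNReal.toReal_nonneg, mul_comm]
      by_cases hq : q.2 ∈ K
      · rw [Set.indicator_of_mem hq]
        gcongr
        exact hC q.2 q.1
      · have h0 : angFourier (slice φ hφ q.2) q.1 = 0 := by
          have : slice φ hφ q.2 = 0 := by
            ext t
            by_contra h1
            exact hq ⟨_, subset_tsupport _ h1, rfl⟩
          rw [this, map_zero]
          rfl
        rw [h0, Set.indicator_of_notMem hq, norm_zero, zero_mul, mul_zero]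
  calc ∫ x : E, ∫ t : W, (((γ t).toReal * (f x).toReal : ℝ) : ℂ) * φ (WithLp.toLp 2 (t, x))
      = ∫ x : E, ∫ τ : W, ((f x).toReal : ℂ) * angFourier (slice φ hφ x) τ ∂ν := by
        refine integral_congr_ae (.of_forall fun x => ?_)
        simp only
        rw [integral_const_mul, ← hν.fourier_eq, ← integral_const_mul]
        refine integral_congr_ae (.of_forall fun t => ?_)
        simp only [slice_apply]
        push_cast
        ring
    _ = ∫ τ : W, (∫ x : E, ((f x).toReal : ℂ) * partialFourier φ hφ τ x) ∂ν :=
        (integral_integral_swap hH).symm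
    _ = ∫ τ : W, ∫ ξ : E, angFourier φ (WithLp.toLp 2 (τ, ξ)) ∂μ ∂ν := by
        refine integral_congr_ae (.of_forall fun τ => ?_)
        simp only
        rw [hμ.fourier_eq]
        simp only [angFourier_partialFourier]

end ProductKernel

/-! ### Convergence of the covariance integral and Plancherel's formula -/

section Covariance

variable {V : Type*} [NormedAddCommGroup V] [InnerProductSpace ℝ V] [FiniteDimensional ℝ V]
  [MeasurableSpace V] [BorelSpace V]

/-- In the coordinates `(x - y, y)` the kernel depends on one variable only. The supports confine `x
- y` to a compact set of differences, where local integrability of `k` suffices. -/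
theorem integrable_shear {k : V → ℝ} (hk : LocallyIntegrable k) {φ₁ φ₂ : V → ℝ}
    (c₁ : Continuous φ₁) (c₂ : Continuous φ₂) (s₁ : HasCompactSupport φ₁)
    (s₂ : HasCompactSupport φ₂) :
    Integrable fun q : V × V => k q.1 * φ₁ (q.1 + q.2) * φ₂ q.2 := by
  have hK : IsCompact ((fun q : V × V => q.1 - q.2) '' (tsupport φ₁ ×ˢ tsupport φ₂)) :=
    (IsCompact.prod s₁ s₂).image (by fun_prop)
  set K := (fun q : V × V => q.1 - q.2) '' (tsupport φ₁ ×ˢ tsupport φ₂)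
  obtain ⟨C, hC⟩ := c₁.bounded_above_of_compact_support s₁
  have h := ((hk.integrableOn_isCompact hK).integrable_indicator hK.measurableSet).mul_prod
    (c₂.integrable_of_hasCompactSupport s₂ (μ := volume))
  have h' := h.bdd_mul (f := fun q : V × V => φ₁ (q.1 + q.2)) (c := C)
    (Continuous.aestronglyMeasurable (by fun_prop)) (.of_forall fun q => hC _)
  refine (funext fun q => ?_ : _ = fun q : V × V => k q.1 * φ₁ (q.1 + q.2) * φ₂ q.2) ▸ h'
  by_cases hq : q.1 ∈ K
  · rw [Set.indicator_of_mem hq]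
    ring
  · rw [Set.indicator_of_notMem hq, zero_mul, mul_zero]
    by_cases h1 : φ₁ (q.1 + q.2) = 0
    · rw [h1, mul_zero, zero_mul]
    by_cases h2 : φ₂ q.2 = 0
    · rw [h2, mul_zero]
    · exact absurd ⟨(q.1 + q.2, q.2), ⟨subset_tsupport _ h1, subset_tsupport _ h2⟩,
        add_sub_cancel_right _ _⟩ hq

theorem integrable_covariance {k : V → ℝ} (hk : LocallyIntegrable k) {φ₁ φ₂ : V → ℝ}
    (c₁ : Continuous φ₁) (c₂ : Continuous φ₂) (s₁ : HasCompactSupport φ₁)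
    (s₂ : HasCompactSupport φ₂) :
    Integrable fun p : V × V => k (p.1 - p.2) * φ₁ p.1 * φ₂ p.2 := by
  have := (measurePreserving_sub_prod (volume : Measure V) volume).integrable_comp_of_integrable
    (integrable_shear hk c₁ c₂ s₁ s₂)
  simp only [Function.comp_def, sub_add_cancel] at this
  exact this

theorem integral_covariance_eq_shear {k : V → ℝ} (hk : LocallyIntegrable k) {φ₁ φ₂ : V → ℝ}
    (c₁ : Continuous φ₁) (c₂ : Continuous φ₂) (s₁ : HasCompactSupport φ₁)
    (s₂ : HasCompactSupport φ₂) :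
    ∫ p : V × V, k (p.1 - p.2) * φ₁ p.1 * φ₂ p.2
      = ∫ q : V × V, k q.1 * φ₁ (q.1 + q.2) * φ₂ q.2 := by
  have hmp := measurePreserving_sub_prod (volume : Measure V) volume
  have h := integrable_shear hk c₁ c₂ s₁ s₂
  rw [Measure.volume_eq_prod] at h ⊢
  have := integral_map hmp.measurable.aemeasurable (hmp.map_eq.symm ▸ h.1)
  rw [hmp.map_eq] at this
  simpa only [sub_add_cancel] using this.symm

/-- Plancherel's formula for the covariance: `J(φ₁, φ₂) = ∫ ℱφ₁ conj(ℱφ₂) dm`. -/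
theorem IsSpectralPair.integral_covariance {k : V → ℝ} {m : Measure V} (h : IsSpectralPair k m)
    {φ₁ φ₂ : V → ℝ} (c₁ : ContDiff ℝ ∞ φ₁) (c₂ : ContDiff ℝ ∞ φ₂) (s₁ : HasCompactSupport φ₁)
    (s₂ : HasCompactSupport φ₂) :
    ((∫ p : V × V, k (p.1 - p.2) * φ₁ p.1 * φ₂ p.2 : ℝ) : ℂ)
      = ∫ ξ, angFourier (ofRealSchwartz φ₁ c₁ s₁) ξ
          * conj (angFourier (ofRealSchwartz φ₂ c₂ s₂) ξ) ∂m := by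
  have := h.tempered
  have := h.sFinite
  set ψ₁ := ofRealSchwartz φ₁ c₁ s₁ with hψ₁
  set ψ₂ := ofRealSchwartz φ₂ c₂ s₂ with hψ₂
  have hcs := hasCompactSupport_ofRealSchwartz φ₁ c₁ s₁
  rw [integral_covariance_eq_shear h.locallyIntegrable c₁.continuous c₂.continuous s₁ s₂,
    ← integral_complex_ofReal, Measure.volume_eq_prod, integral_prod_symm _
    (integrable_shear h.locallyIntegrable c₁.continuous c₂.continuous s₁ s₂).ofReal]
  have hsw : Integrable (fun q : V × V => ψ₂ q.1 * (Complex.exp (-(Complex.I *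
      (inner ℝ q.2 (-q.1) : ℝ))) * angFourier ψ₁ q.2)) (volume.prod m) := by
    have h1 := (ψ₂.integrable (μ := volume)).mul_prod ((angFourier ψ₁).integrable (μ := m))
    have h2 := h1.bdd_mul (f := fun q : V × V => Complex.exp (-(Complex.I *
      (inner ℝ q.2 (-q.1) : ℝ)))) (c := 1) (Continuous.aestronglyMeasurable (by fun_prop))
      (.of_forall fun q => by rw [norm_exp_neg_I_mul])
    refine (integrable_congr (.of_forall fun q => ?_)).1 h2
    ring
  calc ∫ s : V, ∫ q : V, ((k q * φ₁ (q + s) * φ₂ s : ℝ) : ℂ)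
      = ∫ s : V, ∫ ξ : V, ψ₂ s * (Complex.exp (-(Complex.I * (inner ℝ ξ (-s) : ℝ)))
          * angFourier ψ₁ ξ) ∂m := by
        refine integral_congr_ae (.of_forall fun s => ?_)
        simp only
        -- For fixed `s` the inner integral tests `k` against a translate of `φ₁`, whose transform
        -- carries the phase `e^{iξ·s}`. Integrating this phase against the real `φ₂` yields
        -- `conj(ℱφ₂)`.
        have e := h.fourier_eq _ (hasCompactSupport_compSubConst hcs (-s))
        simp only [angFourier_compSubConst] at e
        rw [integral_const_mul]
        refine Eq.trans ?_ (congrArg (ψ₂ s * ·) e)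
        rw [← integral_const_mul]
        refine integral_congr_ae (.of_forall fun q => ?_)
        simp only [compSubConstCLM_apply, sub_neg_eq_add, hψ₂, ofRealSchwartz_apply]
        push_cast
        ring
    _ = ∫ ξ : V, (∫ s : V, ψ₂ s * (Complex.exp (-(Complex.I * (inner ℝ ξ (-s) : ℝ)))
          * angFourier ψ₁ ξ)) ∂m := integral_integral_swap hsw
    _ = ∫ ξ, angFourier ψ₁ ξ * conj (angFourier ψ₂ ξ) ∂m := by
        refine integral_congr_ae (.of_forall fun ξ => ?_)
        simp only
        rw [angFourier_apply ψ₂, ← integral_conj, ← integral_const_mul]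
        refine integral_congr_ae (.of_forall fun s => ?_)
        simp only [map_mul, conj_exp_neg_I_mul, inner_neg_right, hψ₂, ofRealSchwartz_apply,
          Complex.conj_ofReal]
        ring

end Covariance

/-! ### The real Hilbert space of Hermitian `L²` functions -/

section Hermitian

variable {V : Type*} [NormedAddCommGroup V] [InnerProductSpace ℝ V] [FiniteDimensional ℝ V]
  [MeasurableSpace V] [BorelSpace V] {m : Measure V}

/-- The Hermitian functions in `L²(m)`, as a closed real subspace. -/
noncomputable def hermitianLp (hn : MeasurePreserving (fun p : V => -p) m m) :
    Submodule ℝ (Lp ℂ 2 m) :=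
  LinearMap.ker ((Lp.compMeasurePreservingₗᵢ ℝ _ hn).toContinuousLinearMap
    - ContinuousLinearMap.compLpL 2 m (Complex.conjCLE : ℂ →L[ℝ] ℂ)).toLinearMap

omit [InnerProductSpace ℝ V] [FiniteDimensional ℝ V] [BorelSpace V] in
theorem isClosed_hermitianLp (hn : MeasurePreserving (fun p : V => -p) m m) :
    IsClosed (hermitianLp hn : Set (Lp ℂ 2 m)) :=
  ContinuousLinearMap.isClosed_ker _

instance (hn : MeasurePreserving (fun p : V => -p) m m) : CompleteSpace (hermitianLp hn) :=
  (isClosed_hermitianLp hn).completeSpace_coe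

omit [InnerProductSpace ℝ V] [FiniteDimensional ℝ V] [BorelSpace V] in
theorem mem_hermitianLp (hn : MeasurePreserving (fun p : V => -p) m m) {u : Lp ℂ 2 m} :
    u ∈ hermitianLp hn ↔ ∀ᵐ p ∂m, u p = conj (u (-p)) := by
  have h1 := Lp.coeFn_compMeasurePreserving u hn
  have h2 := ContinuousLinearMap.coeFn_compLpL (Complex.conjCLE : ℂ →L[ℝ] ℂ) u
  have h3 : u ∈ hermitianLp hn ↔ Lp.compMeasurePreserving _ hn u
      = ContinuousLinearMap.compLpL 2 m (Complex.conjCLE : ℂ →L[ℝ] ℂ) u := by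
    rw [hermitianLp, LinearMap.mem_ker, ← sub_eq_zero (b := ContinuousLinearMap.compLpL 2 m _ u)]
    rfl
  rw [h3, Lp.ext_iff]
  constructor
  · intro h
    filter_upwards [h, h1, h2] with p e e1 e2
    have e' : u (-p) = conj (u p) := e1.symm.trans (e.trans e2)
    rw [e', Complex.conj_conj]
  · intro h
    filter_upwards [h, h1, h2] with p e e1 e2
    rw [e1, e2]
    change u (-p) = conj (u p)
    rw [e, Complex.conj_conj]

omit [InnerProductSpace ℝ V] [FiniteDimensional ℝ V] [BorelSpace V] in
theorem mem_hermitianLp_toLp (hn : MeasurePreserving (fun p : V => -p) m m) {u : V → ℂ}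
    (hu : MemLp u 2 m) (h : ∀ᵐ p ∂m, u p = conj (u (-p))) : hu.toLp u ∈ hermitianLp hn := by
  rw [mem_hermitianLp]
  have h1 := hu.coeFn_toLp
  filter_upwards [h, h1, hn.quasiMeasurePreserving.ae h1] with p e e1 e2
  rw [e1, e2, e]

omit [InnerProductSpace ℝ V] [FiniteDimensional ℝ V] in
/-- For Hermitian functions `∫ u conj(w) dm` is real. -/
theorem ofReal_inner_of_hermitian (hn : MeasurePreserving (fun p : V => -p) m m) {u w : V → ℂ}
    (hu : MemLp u 2 m) (hw : MemLp w 2 m) (h1 : ∀ᵐ p ∂m, u p = conj (u (-p)))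
    (h2 : ∀ᵐ p ∂m, w p = conj (w (-p))) :
    ((inner ℝ (hu.toLp u) (hw.toLp w) : ℝ) : ℂ) = ∫ p, u p * conj (w p) ∂m := by
  have hint : Integrable (fun p => u p * conj (w p)) m := MemLp.integrable_mul hu hw.star
  have e : inner ℝ (hu.toLp u) (hw.toLp w) = ∫ p, (u p * conj (w p)).re ∂m := by
    rw [L2.inner_def]
    refine integral_congr_ae ?_
    filter_upwards [hu.coeFn_toLp, hw.coeFn_toLp] with p e1 e2
    rw [e1, e2, Complex.inner, mul_comm]
    simp
  -- The substitution `p ↦ -p` preserves `m` and conjugates the integrand.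
  have hreal : conj (∫ p, u p * conj (w p) ∂m) = ∫ p, u p * conj (w p) ∂m := by
    have he : MeasurableEmbedding (fun p : V => -p) := (MeasurableEquiv.neg V).measurableEmbedding
    rw [← integral_conj, ← hn.integral_comp he]
    refine integral_congr_ae ?_
    filter_upwards [h1, h2] with p e1 e2
    rw [map_mul, ← e1, Complex.conj_conj, e2, Complex.conj_conj]
  rw [e]
  have := integral_re hint
  simp only [RCLike.re_eq_complex_re] at this
  rw [this]
  exact Complex.conj_eq_iff_re.1 hreal

end Hermitian

/-! ### Identification of `𝒰` and `ℋ` with the Hermitian functions -/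

section Identification

variable {d : ℕ}

theorem measurableEmbedding_toLp_prod (d : ℕ) :
    MeasurableEmbedding (WithLp.toLp 2 : ℝ × Space d → SpaceTime d) :=
  (MeasurableEquiv.toLp 2 (ℝ × Space d)).measurableEmbedding

/-- The product of the spectral measures, as a measure on space-time. -/
noncomputable def spectralProd (ν : Measure ℝ) (μ : Measure (Space d)) : Measure (SpaceTime d) :=
  (ν.prod μ).map (WithLp.toLp 2)

theorem memLp_onPairs_iff {ν : Measure ℝ} {μ : Measure (Space d)} {v : SpaceTime d → ℂ} :
    MemLp (onPairs v) 2 (ν.prod μ) ↔ MemLp v 2 (spectralProd ν μ) :=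
  (measurableEmbedding_toLp_prod d).memLp_map_measure_iff.symm

theorem integrable_onPairs_iff {ν : Measure ℝ} {μ : Measure (Space d)} {F : SpaceTime d → ℂ} :
    Integrable (onPairs F) (ν.prod μ) ↔ Integrable F (spectralProd ν μ) :=
  (measurableEmbedding_toLp_prod d).integrable_map_iff.symm

theorem integral_onPairs {ν : Measure ℝ} {μ : Measure (Space d)} (F : SpaceTime d → ℂ) :
    ∫ p, onPairs F p ∂(ν.prod μ) = ∫ p, F p ∂(spectralProd ν μ) :=
  ((measurableEmbedding_toLp_prod d).integral_map _).symm

theorem onPairs_ae_eq_zero_iff {ν : Measure ℝ} {μ : Measure (Space d)} {v : SpaceTime d → ℂ} :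
    onPairs v =ᵐ[ν.prod μ] 0 ↔ v =ᵐ[spectralProd ν μ] 0 :=
  ((measurableEmbedding_toLp_prod d).ae_map_iff (p := fun p => v p = 0)).symm

theorem AssumptionA.sFinite {ν : Measure ℝ} {μ : Measure (Space d)} (hA : AssumptionA ν μ) :
    SFinite ν ∧ SFinite μ := by
  obtain ⟨h, g, -, -, -, -, hν, hμ, -⟩ := hA
  have := SigmaFinite.withDensity_ofReal (μ := (volume : Measure ℝ))
    fun τ => (2 * Real.pi)⁻¹ * h τ
  have := SigmaFinite.withDensity_ofReal (μ := (volume : Measure (Space d)))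
    fun ξ => ((2 * Real.pi) ^ d)⁻¹ * g ξ
  rw [hν, hμ]
  exact ⟨inferInstance, inferInstance⟩

/-- The density is the product of the two densities with their powers of `2π`, which only rescale
the slow growth integral. The exponent `k` carries over because the Euclidean norm satisfies `‖(τ,
ξ)‖² = τ² + ‖ξ‖²`. -/
theorem AssumptionA.exists_isSpectralDensity {γ : ℝ → ℝ≥0∞} {f : Space d → ℝ≥0∞}
    {ν : Measure ℝ} {μ : Measure (Space d)} (hγ : IsCovarianceKernel γ) (hf : IsCovarianceKernel f)
    (hν : IsSpectralMeasure γ ν) (hμ : IsSpectralMeasure f μ) (hA : AssumptionA ν μ) :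
    ∃ ρ, IsSpectralDensity (spectralProd ν μ) ρ := by
  obtain ⟨hsν, hsμ⟩ := hA.sFinite
  obtain ⟨h, g, hh, hg, h0, g0, eν, eμ, k, -, hk⟩ := hA
  have hmp := WithLp.volume_preserving_toLp ℝ (Space d)
  have hmp' := WithLp.volume_preserving_ofLp ℝ (Space d)
  have he := measurableEmbedding_toLp_prod d
  have hfst : Measurable fun p : SpaceTime d => p.fst := measurable_fst.comp hmp'.measurable
  have hsnd : Measurable fun p : SpaceTime d => p.snd := measurable_snd.comp hmp'.measurable
  set a : ℝ := (2 * Real.pi)⁻¹ with ha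
  set b : ℝ := ((2 * Real.pi) ^ d)⁻¹ with hb
  have ha0 : 0 < a := by positivity
  have hb0 : 0 < b := by positivity
  have hset (p : SpaceTime d) : 0 < (a * h p.fst) * (b * g p.snd) ↔ 0 < h p.fst * g p.snd := by
    rw [show (a * h p.fst) * (b * g p.snd) = (a * b) * (h p.fst * g p.snd) by ring]
    exact mul_pos_iff_of_pos_left (mul_pos ha0 hb0)
  have hF : Measurable fun p : SpaceTime d =>
      ENNReal.ofReal ((a * h p.fst) * (b * g p.snd)) := by fun_prop
  refine ⟨fun p => (a * h p.fst) * (b * g p.snd), by fun_prop,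
    fun p => mul_nonneg (mul_nonneg ha0.le (h0 _)) (mul_nonneg hb0.le (g0 _)), ?_,
    hasTemperateGrowth_map_toLp hν.tempered hμ.tempered, ?_, k, ?_⟩
  · ext s hs
    rw [spectralProd, Measure.map_apply he.measurable hs, eν, eμ,
      prod_withDensity (by fun_prop) (by fun_prop), withDensity_apply _ (he.measurable hs),
      withDensity_apply _ hs, ← hmp.setLIntegral_comp_preimage hs hF]
    refine lintegral_congr fun q => ?_
    rw [← ENNReal.ofReal_mul (mul_nonneg ha0.le (h0 _))]
    rfl
  · have e1 := hν.density_even hγ.symm (hh.const_mul a) (fun τ => mul_nonneg ha0.le (h0 τ)) eν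
    have e2 := hμ.density_even hf.symm (hg.const_mul b) (fun ξ => mul_nonneg hb0.le (g0 ξ)) eμ
    have q1 := (Measure.quasiMeasurePreserving_fst (μ := (volume : Measure ℝ))
      (ν := (volume : Measure (Space d)))).comp hmp'.quasiMeasurePreserving
    have q2 := (Measure.quasiMeasurePreserving_snd (μ := (volume : Measure ℝ))
      (ν := (volume : Measure (Space d)))).comp hmp'.quasiMeasurePreserving
    filter_upwards [q1.ae e1, q2.ae e2] with p h1 h2
    exact congrArg₂ (· * ·) h1 h2
  · rw [← hmp.integrableOn_comp_preimage he]
    have hpre : (WithLp.toLp 2 : ℝ × Space d → SpaceTime d) ⁻¹'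
        {p | 0 < (a * h p.fst) * (b * g p.snd)} = {p | 0 < h p.1 * g p.2} := by
      ext q
      exact hset (WithLp.toLp 2 q)
    rw [hpre]
    refine (hk.const_mul (a * b)⁻¹).congr (.of_forall fun q => ?_)
    rw [Function.comp_apply, WithLp.prod_norm_sq_eq_of_L2, Real.norm_eq_abs]
    change (a * b)⁻¹ * ((1 / (1 + q.1 ^ 2 + ‖q.2‖ ^ 2)) ^ k * (1 / (h q.1 * g q.2)))
      = (1 / (1 + (|q.1| ^ 2 + ‖q.2‖ ^ 2))) ^ k * (1 / ((a * h q.1) * (b * g q.2)))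
    rw [sq_abs, ← add_assoc, show (a * h q.1) * (b * g q.2) = (a * b) * (h q.1 * g q.2) by ring,
      one_div (a * b * _), mul_inv, one_div (h q.1 * _)]
    ring

variable {ν : Measure ℝ} {μ : Measure (Space d)} {ρ : SpaceTime d → ℝ}

/-- Membership in `spaceU` supplies one square integrable representative. Absolute continuity
transfers this to every representative, so choices do not matter below. -/
theorem IsSpectralDensity.memLp_of_fourierIs (hm : IsSpectralDensity (spectralProd ν μ) ρ)
    (S : spaceU ν μ) {v : SpaceTime d → ℂ} (hv : FourierIs S.1 v) :
    MemLp v 2 (spectralProd ν μ) := by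
  obtain ⟨-, w, hw, hw2⟩ := S.2
  exact (memLp_congr_ae (hm.ae_eq_of_fourierIs hv hw)).2 (memLp_onPairs_iff.1 hw2)

/-- A function that represents the Fourier transform of an element of `spaceU`. -/
noncomputable def fourierFn (S : spaceU ν μ) : SpaceTime d → ℂ := S.2.2.choose

theorem fourierIs_fourierFn (S : spaceU ν μ) : FourierIs S.1 (fourierFn S) := S.2.2.choose_spec.1

/-- The Fourier transform, as a map from `𝒰` to the Hermitian functions in `L²`. -/
noncomputable def fourierU (hm : IsSpectralDensity (spectralProd ν μ) ρ) :
    spaceU ν μ →ₗ[ℝ] hermitianLp hm.measurePreserving_neg where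
  toFun S := ⟨(hm.memLp_of_fourierIs S (fourierIs_fourierFn S)).toLp (fourierFn S),
    mem_hermitianLp_toLp _ _ (hm.hermitian (fourierIs_fourierFn S) S.2.1)⟩
  map_add' S₁ S₂ := Subtype.ext <| by
    refine ((MemLp.toLp_eq_toLp_iff
      (hm.memLp_of_fourierIs (S₁ + S₂) (fourierIs_fourierFn (S₁ + S₂))) _).2 ?_).trans
      (MemLp.toLp_add
      (hm.memLp_of_fourierIs S₁ (fourierIs_fourierFn S₁))
      (hm.memLp_of_fourierIs S₂ (fourierIs_fourierFn S₂)))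
    exact hm.ae_eq_of_fourierIs (fourierIs_fourierFn (S₁ + S₂))
      ((fourierIs_fourierFn S₁).add (fourierIs_fourierFn S₂))
  map_smul' c S := Subtype.ext <| by
    refine ((MemLp.toLp_eq_toLp_iff
      (hm.memLp_of_fourierIs (c • S) (fourierIs_fourierFn (c • S))) _).2 ?_).trans
      (MemLp.toLp_const_smul c
      (hm.memLp_of_fourierIs S (fourierIs_fourierFn S)))
    exact hm.ae_eq_of_fourierIs (fourierIs_fourierFn (c • S)) ((fourierIs_fourierFn S).smul c)

theorem fourierU_apply (hm : IsSpectralDensity (spectralProd ν μ) ρ) (S : spaceU ν μ)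
    {v : SpaceTime d → ℂ} (hv : FourierIs S.1 v) :
    (fourierU hm S : Lp ℂ 2 (spectralProd ν μ)) = (hm.memLp_of_fourierIs S hv).toLp v :=
  (MemLp.toLp_eq_toLp_iff (hm.memLp_of_fourierIs S (fourierIs_fourierFn S)) _).2
    (hm.ae_eq_of_fourierIs (fourierIs_fourierFn S) hv)

theorem fourierU_eq_zero_iff (hm : IsSpectralDensity (spectralProd ν μ) ρ) (S : spaceU ν μ)
    {v : SpaceTime d → ℂ} (hv : FourierIs S.1 v) :
    fourierU hm S = 0 ↔ v =ᵐ[spectralProd ν μ] 0 := by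
  have h := (hm.memLp_of_fourierIs S hv).coeFn_toLp
  rw [← Submodule.coe_eq_zero, fourierU_apply hm S hv, Lp.eq_zero_iff_ae_eq_zero]
  exact ⟨h.symm.trans, h.trans⟩

theorem fourierU_surjective (hm : IsSpectralDensity (spectralProd ν μ) ρ) :
    Function.Surjective (fourierU hm) := by
  rintro ⟨u, hu⟩
  rw [mem_hermitianLp, hm.ae_iff] at hu
  have hmeas : Measurable u := (Lp.stronglyMeasurable u).measurable
  have hset : MeasurableSet {p | 0 < ρ p} := measurableSet_lt measurable_const hm.measurable
  -- The measure does not see `{ρ = 0}`, so setting `u` to zero there keeps its class and makes it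
  -- tempered. Evenness of `ρ` then keeps the cut-off function Hermitian almost everywhere for
  -- Lebesgue measure, as a real distribution requires.
  obtain ⟨k, hk⟩ := hm.exists_integrable_indicator hmeas (Lp.memLp u)
  have hae : u =ᵐ[spectralProd ν μ] {p | 0 < ρ p}.indicator u := by
    refine hm.ae_iff.2 (.of_forall fun p hp => ?_)
    rw [Set.indicator_of_mem (show p ∈ {p | 0 < ρ p} from hp)]
  obtain ⟨S, hS, hF⟩ := exists_isReal_fourierIs (hmeas.indicator hset) hk (by
    filter_upwards [hu, hm.even] with p h1 h2
    by_cases hp : 0 < ρ p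
    · rw [Set.indicator_of_mem (show p ∈ {p | 0 < ρ p} from hp),
        Set.indicator_of_mem (show -p ∈ {p | 0 < ρ p} by rwa [Set.mem_ofPred_eq, h2])]
      exact h1 hp
    · rw [Set.indicator_of_notMem (show p ∉ {p | 0 < ρ p} from hp),
        Set.indicator_of_notMem (show -p ∉ {p | 0 < ρ p} by rwa [Set.mem_ofPred_eq, h2]),
        map_zero])
  refine ⟨⟨S, hS, _, hF, memLp_onPairs_iff.2 ((memLp_congr_ae hae).1 (Lp.memLp u))⟩,
    Subtype.ext ?_⟩
  rw [fourierU_apply hm _ hF]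
  refine Eq.trans ?_ (Lp.toLp_coeFn u (Lp.memLp u))
  rw [MemLp.toLp_eq_toLp_iff]
  exact hae.symm

theorem ker_fourierU (hm : IsSpectralDensity (spectralProd ν μ) ρ) :
    (fourierU hm).ker = nullU ν μ := by
  ext S
  obtain ⟨v, hv, -⟩ := S.2.2
  have h1 : S ∈ (fourierU hm).ker ↔ v =ᵐ[spectralProd ν μ] 0 := by
    rw [LinearMap.mem_ker, fourierU_eq_zero_iff hm S hv]
  rw [h1]
  constructor
  · exact fun h => ⟨v, hv, onPairs_ae_eq_zero_iff.2 h⟩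
  · rintro ⟨w, hw, h0⟩
    exact (hm.ae_eq_of_fourierIs hv hw).trans (onPairs_ae_eq_zero_iff.1 h0)

/-- The Fourier transform identifies `𝒰` with the Hermitian functions in `L²`. -/
noncomputable def quotUEquiv (hm : IsSpectralDensity (spectralProd ν μ) ρ) :
    QuotU ν μ ≃ₗ[ℝ] hermitianLp hm.measurePreserving_neg :=
  (Submodule.quotEquivOfEq _ _ (ker_fourierU hm).symm).trans
    ((fourierU hm).quotKerEquivOfSurjective (fourierU_surjective hm))

theorem inner_fourierU (hm : IsSpectralDensity (spectralProd ν μ) ρ) (S₁ S₂ : spaceU ν μ)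
    {v₁ v₂ : SpaceTime d → ℂ} (h₁ : FourierIs S₁.1 v₁) (h₂ : FourierIs S₂.1 v₂) :
    ((inner ℝ (fourierU hm S₁) (fourierU hm S₂) : ℝ) : ℂ)
      = ∫ p, v₁ p * conj (v₂ p) ∂(spectralProd ν μ) := by
  rw [Submodule.coe_inner, fourierU_apply hm S₁ h₁, fourierU_apply hm S₂ h₂]
  exact ofReal_inner_of_hermitian hm.measurePreserving_neg _ _ (hm.hermitian h₁ S₁.2.1)
    (hm.hermitian h₂ S₂.2.1)

theorem fourierIs_testDistribution (φ : TestFn d) :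
    FourierIs (testDistribution φ) (angFourier (testSchwartz φ)) where
  measurable := (angFourier (testSchwartz φ)).continuous.measurable
  locallyIntegrable := (angFourier (testSchwartz φ)).continuous.locallyIntegrable
  apply_eq ψ _ := by
    rw [testDistribution_apply, integral_angFourier_mul]
    rfl

theorem isRealDistribution_testDistribution (φ : TestFn d) :
    IsRealDistribution (testDistribution φ) := by
  intro ψ hψ
  rw [testDistribution_apply, ← Complex.conj_eq_iff_im, ← integral_conj]
  refine integral_congr_ae (.of_forall fun z => ?_)
  simp only [map_mul, Complex.conj_ofReal, Complex.conj_eq_iff_im.2 (hψ z)]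

/-- The inclusion of the test functions into `𝒰`. -/
noncomputable def testU (hm : IsSpectralDensity (spectralProd ν μ) ρ) :
    TestFn d →ₗ[ℝ] spaceU ν μ where
  toFun φ := ⟨testDistribution φ, isRealDistribution_testDistribution φ, _,
    fourierIs_testDistribution φ, memLp_onPairs_iff.2 (hm.memLp_schwartz _)⟩
  map_add' φ₁ φ₂ := by
    refine Subtype.ext ?_
    have : testSchwartz (φ₁ + φ₂) = testSchwartz φ₁ + testSchwartz φ₂ := by
      ext z
      change ((φ₁ + φ₂) z : ℂ) = (φ₁ z : ℂ) + (φ₂ z : ℂ)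
      rw [_root_.add_apply, Complex.ofReal_add]
    simp only [testDistribution, this, map_add]
    rfl
  map_smul' c φ := by
    refine Subtype.ext ?_
    have : testSchwartz (c • φ) = (c : ℂ) • testSchwartz φ := by
      ext z
      change ((c • φ) z : ℂ) = (c : ℂ) * (φ z : ℂ)
      rw [_root_.smul_apply, smul_eq_mul, Complex.ofReal_mul]
    simp only [testDistribution, this, map_smul]
    rfl

variable {γ : ℝ → ℝ≥0∞} {f : Space d → ℝ≥0∞}

/-- The kernel `γ(t) f(x)` on space-time. -/
noncomputable def noiseKernel (γ : ℝ → ℝ≥0∞) (f : Space d → ℝ≥0∞) (p : SpaceTime d) : ℝ :=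
  (γ p.fst).toReal * (f p.snd).toReal

theorem ofReal_noiseCov (hk : IsSpectralPair (noiseKernel γ f) (spectralProd ν μ))
    (φ₁ φ₂ : TestFn d) : ((noiseCov γ f φ₁ φ₂ : ℝ) : ℂ)
      = ∫ p, angFourier (testSchwartz φ₁) p * conj (angFourier (testSchwartz φ₂) p)
          ∂(spectralProd ν μ) :=
  hk.integral_covariance φ₁.contDiff φ₂.contDiff φ₁.hasCompactSupport φ₂.hasCompactSupport

theorem noiseCov_eq_inner (hm : IsSpectralDensity (spectralProd ν μ) ρ)
    (hk : IsSpectralPair (noiseKernel γ f) (spectralProd ν μ)) (φ₁ φ₂ : TestFn d) :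
    noiseCov γ f φ₁ φ₂ = inner ℝ (fourierU hm (testU hm φ₁)) (fourierU hm (testU hm φ₂)) := by
  rw [← Complex.ofReal_inj, ofReal_noiseCov hk, inner_fourierU hm _ _
    (fourierIs_testDistribution φ₁) (fourierIs_testDistribution φ₂)]

/-- Apart from absolute convergence, every property is pulled back from the inner product of
`hermitianLp` along the linear Fourier map. -/
theorem isPreInner (hm : IsSpectralDensity (spectralProd ν μ) ρ)
    (hk : IsSpectralPair (noiseKernel γ f) (spectralProd ν μ)) : IsPreInner γ f where
  integrable φ₁ φ₂ := integrable_covariance hk.locallyIntegrable φ₁.continuous φ₂.continuous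
    φ₁.hasCompactSupport φ₂.hasCompactSupport
  symm φ₁ φ₂ := by
    rw [noiseCov_eq_inner hm hk, noiseCov_eq_inner hm hk, real_inner_comm]
  nonneg φ := by
    rw [noiseCov_eq_inner hm hk]
    exact real_inner_self_nonneg
  add_left φ₁ φ₂ φ₃ := by
    simp only [noiseCov_eq_inner hm hk, map_add, inner_add_left]
  smul_left c φ₁ φ₂ := by
    simp only [noiseCov_eq_inner hm hk, map_smul]
    exact real_inner_smul_left (F := hermitianLp hm.measurePreserving_neg) _ _ _

/-- The Fourier transform as an isometry from the test functions with inner product `J`. -/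
noncomputable def fourierPreH (hm : IsSpectralDensity (spectralProd ν μ) ρ)
    (hk : IsSpectralPair (noiseKernel γ f) (spectralProd ν μ)) (hJ : IsPreInner γ f) :
    PreH hJ →ₗᵢ[ℝ] hermitianLp hm.measurePreserving_neg :=
  ((fourierU hm ∘ₗ testU hm) ∘ₗ (toPreH hJ).symm.toLinearMap).isometryOfInner fun φ₁ φ₂ =>
    (noiseCov_eq_inner hm hk φ₁ φ₂).symm

/-- A real compactly supported Schwartz function as a test function. -/
noncomputable def testFnOfReal (φ : 𝓢(SpaceTime d, ℂ)) (hφ : HasCompactSupport φ) : TestFn d where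
  toFun z := (φ z).re
  contDiff' := Complex.reCLM.contDiff.comp (φ.smooth ⊤)
  hasCompactSupport' := hφ.comp_left Complex.zero_re
  tsupport_subset' _ _ := trivial

theorem testSchwartz_testFnOfReal {φ : 𝓢(SpaceTime d, ℂ)} (hφ : HasCompactSupport φ)
    (hr : ∀ x, (φ x).im = 0) : testSchwartz (testFnOfReal φ hφ) = φ := by
  ext z
  exact Complex.ext rfl (hr z).symm

theorem denseRange_fourierPreH (hm : IsSpectralDensity (spectralProd ν μ) ρ)
    (hk : IsSpectralPair (noiseKernel γ f) (spectralProd ν μ)) (hJ : IsPreInner γ f) :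
    DenseRange (fourierPreH hm hk hJ) := by
  have h : (fourierPreH hm hk hJ).toLinearMap.range.topologicalClosure = ⊤ := by
    rw [Submodule.topologicalClosure_eq_top_iff, Submodule.eq_bot_iff]
    intro u hu
    -- Writing `u` as a Fourier transform lets `inner_fourierU` turn real orthogonality into
    -- vanishing of the full complex integral.
    obtain ⟨S, rfl⟩ := fourierU_surjective hm u
    obtain ⟨v, hv, -⟩ := S.2.2
    rw [fourierU_eq_zero_iff hm S hv]
    refine hm.ae_eq_zero_of_orthogonal (hm.memLp_of_fourierIs S hv) fun φ hr hφ => ?_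
    have e := inner_fourierU hm S (testU hm (testFnOfReal φ hφ)) hv
      (fourierIs_testDistribution _)
    rw [testSchwartz_testFnOfReal hφ hr] at e
    rw [← e, Complex.ofReal_eq_zero]
    exact Submodule.inner_left_of_mem_orthogonal
      (LinearMap.mem_range_self _ (toPreH hJ (testFnOfReal φ hφ))) hu
  intro u
  have : u ∈ (fourierPreH hm hk hJ).toLinearMap.range.topologicalClosure := h ▸ Submodule.mem_top
  exact this

/-- The Fourier transform identifies `ℋ` with the Hermitian functions in `L²`. -/
noncomputable def hilbertHEquiv (hm : IsSpectralDensity (spectralProd ν μ) ρ)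
    (hk : IsSpectralPair (noiseKernel γ f) (spectralProd ν μ)) (hJ : IsPreInner γ f) :
    HilbertH hJ ≃ₗᵢ[ℝ] hermitianLp hm.measurePreserving_neg :=
  have hiso : Isometry (fourierPreH hm hk hJ).toContinuousLinearMap.fromCompletion :=
    (fourierPreH hm hk hJ).isometry.completion_extension
  LinearIsometryEquiv.ofSurjective
    ⟨(fourierPreH hm hk hJ).toContinuousLinearMap.fromCompletion.toLinearMap,
      hiso.norm_map_of_map_zero (map_zero _)⟩ <| by
    have hd : DenseRange (fourierPreH hm hk hJ).toContinuousLinearMap.fromCompletion := by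
      refine (denseRange_fourierPreH hm hk hJ).mono ?_
      rintro _ ⟨φ, rfl⟩
      exact ⟨φ, ContinuousLinearMap.fromCompletion_apply_coe _ _⟩
    -- An isometry out of a complete space has closed range; being dense as well, the range is
    -- everything.
    exact Set.range_eq_univ.1 (hiso.isClosedEmbedding.isClosed_range.closure_eq ▸ hd.closure_range)

theorem hilbertHEquiv_toH (hm : IsSpectralDensity (spectralProd ν μ) ρ)
    (hk : IsSpectralPair (noiseKernel γ f) (spectralProd ν μ)) (hJ : IsPreInner γ f)
    (φ : TestFn d) : hilbertHEquiv hm hk hJ (toH hJ φ) = fourierU hm (testU hm φ) :=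
  ContinuousLinearMap.fromCompletion_apply_coe
    (fourierPreH hm hk hJ).toContinuousLinearMap (toPreH hJ φ)

end Identification

end ColoredNoise

theorem mainTheorem6 {d : ℕ} (hd : 1 ≤ d)
    (γ : ℝ → ℝ≥0∞) (f : ColoredNoise.Space d → ℝ≥0∞)
    (hγ : ColoredNoise.IsCovarianceKernel γ) (hf : ColoredNoise.IsCovarianceKernel f)
    (ν : Measure ℝ) (μ : Measure (ColoredNoise.Space d))
    (hν : ColoredNoise.IsSpectralMeasure γ ν) (hμ : ColoredNoise.IsSpectralMeasure f μ)
    (hA : ColoredNoise.AssumptionA ν μ) :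
    ∃ (hJ : ColoredNoise.IsPreInner γ f)
      (Φ : ColoredNoise.QuotU ν μ ≃ₗ[ℝ] ColoredNoise.HilbertH hJ),
      (∀ φ : ColoredNoise.TestFn d,
        ∃ hφ : ColoredNoise.testDistribution φ ∈ ColoredNoise.spaceU ν μ,
          Φ (Submodule.Quotient.mk ⟨ColoredNoise.testDistribution φ, hφ⟩)
            = ColoredNoise.toH hJ φ) ∧
      ∀ (S₁ S₂ : ColoredNoise.spaceU ν μ) (v₁ v₂ : ColoredNoise.SpaceTime d → ℂ),
        ColoredNoise.FourierIs S₁.1 v₁ → ColoredNoise.FourierIs S₂.1 v₂ →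
        Integrable
          (fun p => ColoredNoise.onPairs v₁ p * (starRingEnd ℂ) (ColoredNoise.onPairs v₂ p))
          (ν.prod μ) ∧
        ((inner ℝ (Φ (Submodule.Quotient.mk S₁)) (Φ (Submodule.Quotient.mk S₂)) : ℝ) : ℂ)
          = ∫ p, ColoredNoise.onPairs v₁ p * (starRingEnd ℂ) (ColoredNoise.onPairs v₂ p)
              ∂(ν.prod μ) := by
  open ColoredNoise in
  obtain ⟨ρ, hm⟩ := hA.exists_isSpectralDensity hγ hf hν hμ
  obtain ⟨_, _⟩ := hA.sFinite
  have hk : IsSpectralPair (noiseKernel γ f) (spectralProd ν μ) := isSpectralPair_prod hγ hf hν hμ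
  have hJ := isPreInner hm hk
  -- Both identifications send a test function to its Fourier transform, so the composite respects
  -- the canonical images. The second is an isometry, so the inner product formula follows from that
  -- in `hermitianLp`.
  refine ⟨hJ, (quotUEquiv hm).trans (hilbertHEquiv hm hk hJ).symm.toLinearEquiv,
    fun φ => ⟨(testU hm φ).2, ?_⟩, fun S₁ S₂ v₁ v₂ h₁ h₂ => ⟨?_, ?_⟩⟩
  · change (hilbertHEquiv hm hk hJ).symm (fourierU hm (testU hm φ)) = toH hJ φ
    rw [← hilbertHEquiv_toH hm hk hJ, LinearIsometryEquiv.symm_apply_apply]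
  · refine (integrable_onPairs_iff (F := fun p => v₁ p * (starRingEnd ℂ) (v₂ p))).2 ?_
    exact MemLp.integrable_mul (hm.memLp_of_fourierIs S₁ h₁) (hm.memLp_of_fourierIs S₂ h₂).star
  · refine Eq.trans ?_ (integral_onPairs fun p => v₁ p * (starRingEnd ℂ) (v₂ p)).symm
    rw [← inner_fourierU hm S₁ S₂ h₁ h₂, Complex.ofReal_inj]
    exact (hilbertHEquiv hm hk hJ).symm.inner_map_map _ _
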